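/- Let $k$ be an algebraically closed field and let $f\in k[x,y]$ be squarefree and Newton non-degenerate, i.e. for every (compact) face $\Phi$ of its Newton polygon at the origin, the part $f_\Phi$ of $f$ supported on $\Phi$ and its two partial derivatives have no common zero in $(k^\times)^2$. Assume that the curve $\{f=0\}$ passes through the origin and is singular there. For $\omega\in\mathbf R_{\ge 0}^2$ and $0\neq g\in k[[x,y]]$ put $\nu_\omega(g)=\min\{\omega\cdot(a,b): x^ay^b \text{ occurs in } g\}$, and let $T(g)$, the tropical variety of $g$, be the union of the cones of the dual Newton fan that correspond to the compact segments of the Newton polygon of $g$; explicitly, the set of $\omega\in\mathbf R_{\ge0}^2$ for which $\omega\cdot(a,b)=\nu_\omega(g)$ for all $(a,b)$ on some compact segment of the Newton polygon of $g$. Let $\mathbf A^2_m=k^{2(m+1)}$ be the $m$-th jet space of the plane, with coordinates $x^{(0)},\dots,x^{(m)},y^{(0)},\dots,y^{(m)}$, and write $g\bigl(\sum_j x^{(j)}t^j,\sum_j y^{(j)}t^j\bigr)=\sum_j g^{(j)}t^j$. For $\alpha=(\alpha_1,\alpha_2)$ with positive integer entries and $n\ge 0$ put $$G^\alpha_n\cap\mathbf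 A^2_m=\{x^{(i)}=0\ (i<\alpha_1),\ y^{(i)}=0\ (i<\alpha_2),\ x^{(\alpha_1)}\ne0,\ y^{(\alpha_2)}\neq 0,\ g^{(j)}=0\ (0\le j\le n)\}\subseteq\mathbf A^2_m ,$$ and let a bar denote Zariski closure in $\mathbf A^2_m$. When $g=f_l$, this set is written $F^{\alpha}_{l,n}\cap\mathbf A^2_m$. **Theorem.** Let $f_i,f_j$ be branches of $f$ at the origin, i.e. irreducible factors of $f$ in $k[[x,y]]$, and for $l\in\{i,j\}$ let $\alpha_l$ be a vector with positive integer entries such that $T(f_l)=\mathbf R_{\ge0}\,\alpha_l$. Let $m\geq \nu_{\alpha_l}(f)$ for both $l\in\{i,j\}$ and put $k_l=\nu_{\alpha_l}(f_l)+m-\nu_{\alpha_l}(f)$. If $$F^{\alpha_i}_{i,k_i}\cap\mathbf A^2_m\subseteq\overline{F^{\alpha_j}_{j,k_j}\cap\mathbf A^2_m},$$ then $\alpha_i=\alpha_j$ and $$\overline{F^{\alpha_i}_{i,k_i}\cap\mathbf A^2_m}=\overline{F^{\alpha_j}_{j,k_j}\cap\mathbf A^2_m}.$$ Moreover $f_i$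 and $f_j$ are the same branch, i.e. they are equal up to a unit of $k[[x,y]]$. -/

import Mathlib

namespace NewtonJets

noncomputable section

/-! ### Newton polygon, weights, tropical variety -/

/-- The exponent `(a, b)` of a monomial `x ^ a * y ^ b`, seen as a point of the real plane. -/
def toPlane (d : Fin 2 →₀ ℕ) : Fin 2 → ℝ := fun c => (d c : ℝ)

/-- The exponents that occur in a power series in `x = X 0` and `y = X 1`. -/
def supp {k : Type*} [Field k] (f : MvPowerSeries (Fin 2) k) : Set (Fin 2 →₀ ℕ) :=
  {d | MvPowerSeries.coeff d f ≠ 0}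

/-- `Γ⁺(f)`: the convex hull of the union of the translated quadrants `d + ℝ²_{≥ 0}`,
where `d` runs through the exponents of `f`. -/
def newtonRegion {k : Type*} [Field k] (f : MvPowerSeries (Fin 2) k) : Set (Fin 2 → ℝ) :=
  convexHull ℝ {v | ∃ d ∈ supp f, toPlane d ≤ v}

/-- The faces (vertices and compact segments) of the Newton polygon of `f`:
the nonempty compact faces of `Γ⁺(f)`. -/
def IsNewtonFace {k : Type*} [Field k] (f : MvPowerSeries (Fin 2) k)
    (Φ : Set (Fin 2 → ℝ)) : Prop :=
  IsExposed ℝ (newtonRegion f) Φ ∧ Φ.Nonempty ∧ IsCompact Φ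

/-- `ν_ω(f) = min {ω · d : d an exponent of f}`, for a weight `ω` with nonnegative entries in
`R = ℕ` or `R = ℝ`. -/
def newtonOrder {R : Type*} [Semiring R] [InfSet R] {k : Type*} [Field k]
    (ω : Fin 2 → R) (f : MvPowerSeries (Fin 2) k) : R :=
  sInf {r | ∃ d ∈ supp f, r = ω 0 * (d 0 : R) + ω 1 * (d 1 : R)}

/-- The supporting line `H_ω(f)`. -/
def supportingLine {k : Type*} [Field k] (ω : Fin 2 → ℝ) (f : MvPowerSeries (Fin 2) k) :
    Set (Fin 2 → ℝ) :=
  {v | ω 0 * v 0 + ω 1 * v 1 = newtonOrder ω f}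

/-- The cone of the dual Newton fan attached to a face `Φ`. -/
def dualCone {k : Type*} [Field k] (f : MvPowerSeries (Fin 2) k) (Φ : Set (Fin 2 → ℝ)) :
    Set (Fin 2 → ℝ) :=
  {ω | (∀ c, 0 ≤ ω c) ∧ Φ ⊆ supportingLine ω f}

/-- The tropical variety `T(f)`: the union of the cones dual to the compact segments (the faces
with more than one point) of the Newton polygon. -/
def tropicalVariety {k : Type*} [Field k] (f : MvPowerSeries (Fin 2) k) : Set (Fin 2 → ℝ) :=
  {ω | ∃ Φ, IsNewtonFace f Φ ∧ Φ.Nontrivial ∧ ω ∈ dualCone f Φ}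

/-- The half-line `ℝ_{≥ 0} α`. -/
def ray (α : Fin 2 → ℕ) : Set (Fin 2 → ℝ) :=
  {ω | ∃ s : ℝ, 0 ≤ s ∧ ∀ c, ω c = s * (α c : ℝ)}

/-! ### Newton plane curves and their branches -/

open Classical in
/-- `f_Φ`: the sum of the terms of `f` whose exponents lie on `Φ`. -/
def facePart {k : Type*} [Field k] (f : MvPolynomial (Fin 2) k) (Φ : Set (Fin 2 → ℝ)) :
    MvPolynomial (Fin 2) k :=
  ∑ d ∈ f.support with toPlane d ∈ Φ, MvPolynomial.monomial d (MvPolynomial.coeff d f)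

/-- `f` is a reduced equation of a Newton non-degenerate plane curve: it is squarefree, and for
every face `Φ` of its Newton polygon, `f_Φ` and its two partial derivatives have no common zero
in the torus. -/
structure IsNewtonPlaneCurve {k : Type*} [Field k] (f : MvPolynomial (Fin 2) k) : Prop where
  squarefree : Squarefree f
  nondegenerate : ∀ Φ, IsNewtonFace (f : MvPowerSeries (Fin 2) k) Φ →
    ¬ ∃ a : Fin 2 → k, (∀ c, a c ≠ 0) ∧ MvPolynomial.eval a (facePart f Φ) = 0 ∧
      ∀ c, MvPolynomial.eval a (MvPolynomial.pderiv c (facePart f Φ)) = 0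

/-- The curve `f = 0` passes through the origin and is singular there. -/
def IsSingularAtOrigin {k : Type*} [Field k] (f : MvPolynomial (Fin 2) k) : Prop :=
  MvPolynomial.eval 0 f = 0 ∧ ∀ c, MvPolynomial.eval 0 (MvPolynomial.pderiv c f) = 0

/-- `g` defines a branch at the origin of the curve `f = 0`: it is an irreducible factor of `f`
in `k[[x, y]]`. -/
def IsBranch {k : Type*} [Field k] (f : MvPolynomial (Fin 2) k)
    (g : MvPowerSeries (Fin 2) k) : Prop :=
  Irreducible g ∧ g ∣ (f : MvPowerSeries (Fin 2) k)

/-! ### Jets of the plane -/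

/-- The points of the `m`-th jet space `𝐀²_m`, an affine space of dimension `2 (m + 1)`:
`z (0, j)` is the coordinate `x^(j)` and `z (1, j)` is the coordinate `y^(j)`. -/
abbrev JetPlane (k : Type*) (m : ℕ) : Type _ := Fin 2 × Fin (m + 1) → k

/-- The power series `x(t)` (for `c = 0`) and `y(t)` (for `c = 1`) of a jet; the coefficients
of `t ^ j` with `j > m` are zero. -/
def jetSeries {k : Type*} [Field k] {m : ℕ} (z : JetPlane k m) (c : Fin 2) : PowerSeries k :=
  PowerSeries.mk fun j => if h : j < m + 1 then z (c, ⟨j, h⟩) else 0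

/-- `g(x(t), y(t))`. It is only used for jets with `x^(0) = y^(0) = 0`, for which the substitution
makes sense for every power series `g`. -/
def pullback {k : Type*} [Field k] {m : ℕ} (g : MvPowerSeries (Fin 2) k) (z : JetPlane k m) :
    PowerSeries k :=
  MvPowerSeries.subst (jetSeries z) g

/-- `G^α_n ∩ 𝐀²_m`: the jets with `x^(i) = 0` for `i < α 0`, `y^(i) = 0` for `i < α 1`,
`x^(α 0) ≠ 0`, `y^(α 1) ≠ 0` and `g^(j) = 0` for `j ≤ n`, where `g(x(t), y(t)) = ∑ g^(j) t ^ j`. -/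
def jetStratum {k : Type*} [Field k] (g : MvPowerSeries (Fin 2) k) (α : Fin 2 → ℕ) (n m : ℕ) :
    Set (JetPlane k m) :=
  {z | (∀ c, ∀ i < α c, PowerSeries.coeff i (jetSeries z c) = 0) ∧
    (∀ c, PowerSeries.coeff (α c) (jetSeries z c) ≠ 0) ∧
    ∀ j ≤ n, PowerSeries.coeff j (pullback g z) = 0}

/-- The Zariski closure of a set of points of an affine space. -/
def zariskiClosure {k : Type*} [Field k] {σ : Type*} (S : Set (σ → k)) : Set (σ → k) :=
  MvPolynomial.zeroLocus k (MvPolynomial.vanishingIdeal k S)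

end

end NewtonJets

namespace NewtonJets

open MvPowerSeries Finsupp

noncomputable section

/-! ### Weights, initial forms and their zeros in the torus. -/

section Weights

variable {k : Type*} [Field k]

/-! Write `f = g u = h v` with `g`, `h` the two branches and `α`, `β` their weights. Then `k_i = m -
ν_α(u)` and `k_j = m - ν_β(v)`.

Along an arc `x_c = t ^ α_c w_c`, the coefficient of `t ^ (ν_α(g) + n)` in `g`, for `n > 0`, is
affine in the `n`-th coefficients of `w`; their factors are the partial derivatives of the initial
form of `g` at `w(0)` (`jetCoeff_sub`). Where the initial form is smooth in the torus, the equations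
can therefore be solved one coefficient at a time, with any prescribed right-hand sides
(`exists_lift`).

Same branch (`associated_of_subset_zariskiClosure`): the inclusion forces `β ≤ α` entrywise. Since
`α ∈ T(g)`, the initial form of `g` has two terms and hence a torus zero `a`. Nondegeneracy of `f`
makes `g` smooth at `a` and the initial form of `u` nonzero there. If `g` and `h` were not
associated, the prime `h` would divide `u`. But a jet of the first stratum starting at `a` satisfies
the equations of `h` up to order `k_j ≥ ν_α(h)`, so the initial form of `h`, and with it that of
`u`, vanishes at `a`.

Same weight (`eq_of_subset_zariskiClosure`): now `α = s β` with `s ≥ 1`. Suppose `s > 1`. If `u` is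
not a unit, then `ν_β(u) < ν_α(u)`, so `k_j > k_i`: the closure satisfies an equation that fails at
some jet of the first stratum. If `u` is a unit, both strata are cut out by all equations up to
order `m` and dimensions decide. The stratum of weight `α` has dimension `m + 1 + ν_α(g) - α_0 -
α_1`, so the inclusion gives `(s - 1)(ν_β(g) - β_0 - β_1) ≤ 0`. This contradicts `ν_β(g) > β_0 +
β_1` (`add_lt_newtonOrder`), the only place where the singularity of `f` enters. -/

theorem weight_fin_two (α : Fin 2 → ℕ) (d : Fin 2 →₀ ℕ) :
    weight α d = α 0 * d 0 + α 1 * d 1 := by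
  rw [weight_apply, sum_fintype _ _ (by simp), Fin.sum_univ_two]
  simp [mul_comm]

theorem supp_nonempty {g : MvPowerSeries (Fin 2) k} (hg : g ≠ 0) : (supp g).Nonempty := by
  obtain ⟨d, hd⟩ := (MvPowerSeries.ne_zero_iff_exists_coeff_ne_zero _).1 hg
  exact ⟨d, hd⟩

theorem newtonOrder_eq_sInf (α : Fin 2 → ℕ) (g : MvPowerSeries (Fin 2) k) :
    newtonOrder α g = sInf (weight α '' supp g) := by
  unfold newtonOrder
  congr 1
  ext r
  simp only [Set.mem_ofPred_eq, Set.mem_image, weight_fin_two, Nat.cast_id]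
  exact ⟨fun ⟨d, h, e⟩ => ⟨d, h, e.symm⟩, fun ⟨d, h, e⟩ => ⟨d, h, e.symm⟩⟩

theorem newtonOrder_le_weight (α : Fin 2 → ℕ) {g : MvPowerSeries (Fin 2) k} {d : Fin 2 →₀ ℕ}
    (hd : coeff d g ≠ 0) : newtonOrder α g ≤ weight α d := by
  rw [newtonOrder_eq_sInf]
  exact Nat.sInf_le ⟨d, hd, rfl⟩

theorem exists_weight_eq_newtonOrder (α : Fin 2 → ℕ) {g : MvPowerSeries (Fin 2) k} (hg : g ≠ 0) :
    ∃ d, coeff d g ≠ 0 ∧ weight α d = newtonOrder α g := by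
  rw [newtonOrder_eq_sInf]
  obtain ⟨d, hd, e⟩ := Nat.sInf_mem ((supp_nonempty hg).image (weight α))
  exact ⟨d, hd, e⟩

theorem newtonOrder_mono {α β : Fin 2 → ℕ} (h : ∀ c, α c ≤ β c) {g : MvPowerSeries (Fin 2) k}
    (hg : g ≠ 0) : newtonOrder α g ≤ newtonOrder β g := by
  obtain ⟨d, hd, e⟩ := exists_weight_eq_newtonOrder β hg
  rw [← e]
  refine (newtonOrder_le_weight α hd).trans ?_
  rw [weight_fin_two, weight_fin_two]
  gcongr <;> exact h _

theorem weightedOrder_eq_newtonOrder (α : Fin 2 → ℕ) {g : MvPowerSeries (Fin 2) k} (hg : g ≠ 0) :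
    g.weightedOrder α = newtonOrder α g := by
  rw [weightedOrder_eq_nat]
  refine ⟨exists_weight_eq_newtonOrder α hg, fun d hd => ?_⟩
  by_contra h
  exact absurd (newtonOrder_le_weight α h) (not_le.2 hd)

theorem newtonOrder_mul (α : Fin 2 → ℕ) {g h : MvPowerSeries (Fin 2) k} (hg : g ≠ 0)
    (hh : h ≠ 0) : newtonOrder α (g * h) = newtonOrder α g + newtonOrder α h := by
  have := weightedOrder_mul α g h
  rw [weightedOrder_eq_newtonOrder α hg, weightedOrder_eq_newtonOrder α hh,
    weightedOrder_eq_newtonOrder α (mul_ne_zero hg hh)] at this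
  exact_mod_cast this

theorem newtonOrder_eq_zero_of_isUnit (α : Fin 2 → ℕ) {u : MvPowerSeries (Fin 2) k}
    (hu : IsUnit u) : newtonOrder α u = 0 := by
  have h : coeff 0 u ≠ 0 := by
    rw [coeff_zero_eq_constantCoeff_apply]
    exact (hu.map constantCoeff).ne_zero
  simpa using newtonOrder_le_weight α h

theorem newtonOrder_lt_of_lt {α β : Fin 2 → ℕ} (h : ∀ c, α c < β c)
    {g : MvPowerSeries (Fin 2) k} (hg : g ≠ 0) (hu : ¬ IsUnit g) :
    newtonOrder α g < newtonOrder β g := by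
  obtain ⟨d, hd, e⟩ := exists_weight_eq_newtonOrder β hg
  rw [← e]
  refine (newtonOrder_le_weight α hd).trans_lt ?_
  have h0 : d ≠ 0 := by
    rintro rfl
    refine hu (MvPowerSeries.isUnit_iff_constantCoeff.2 ?_)
    rw [coeff_zero_eq_constantCoeff_apply] at hd
    exact hd.isUnit
  rw [weight_fin_two, weight_fin_two]
  have h1 : d 0 ≠ 0 ∨ d 1 ≠ 0 := by
    by_contra hc
    push Not at hc
    exact h0 (Finsupp.ext (Fin.forall_fin_two.2 (by simpa using hc)))
  have := h 0
  have := h 1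
  rcases h1 with h1 | h1
  · have : α 0 * d 0 < β 0 * d 0 := by
      apply Nat.mul_lt_mul_of_pos_right ‹_› (by omega)
    have : α 1 * d 1 ≤ β 1 * d 1 := Nat.mul_le_mul_right _ (by omega)
    omega
  · have : α 1 * d 1 < β 1 * d 1 := by
      apply Nat.mul_lt_mul_of_pos_right ‹_› (by omega)
    have : α 0 * d 0 ≤ β 0 * d 0 := Nat.mul_le_mul_right _ (by omega)
    omega

/-- The part of weight `n` of a power series, for a weight with positive entries. -/
def wpart (g : MvPowerSeries (Fin 2) k) (α : Fin 2 → ℕ) (n : ℕ) : MvPolynomial (Fin 2) k :=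
  ∑ d ∈ Finset.Iic (equivFunOnFinite.symm fun _ : Fin 2 => n) with weight α d = n,
    MvPolynomial.monomial d (coeff d g)

theorem le_weight_apply {α : Fin 2 → ℕ} (hα : ∀ c, 0 < α c) (d : Fin 2 →₀ ℕ) (c : Fin 2) :
    d c ≤ weight α d := by
  rw [weight_fin_two]
  have h0 := Nat.le_mul_of_pos_left (d 0) (hα 0)
  have h1 := Nat.le_mul_of_pos_left (d 1) (hα 1)
  fin_cases c <;> simp <;> omega

theorem coeff_wpart {α : Fin 2 → ℕ} (hα : ∀ c, 0 < α c) (g : MvPowerSeries (Fin 2) k) (n : ℕ)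
    (d : Fin 2 →₀ ℕ) :
    MvPolynomial.coeff d (wpart g α n) = if weight α d = n then coeff d g else 0 := by
  classical
  rw [wpart, MvPolynomial.coeff_sum]
  simp only [MvPolynomial.coeff_monomial]
  rw [Finset.sum_ite_eq']
  refine if_congr ?_ rfl rfl
  simp only [Finset.mem_filter, Finset.mem_Iic, and_iff_right_iff_imp]
  rintro rfl c
  exact le_weight_apply hα d c

theorem isWeightedHomogeneous_wpart {α : Fin 2 → ℕ} (hα : ∀ c, 0 < α c)
    (g : MvPowerSeries (Fin 2) k) (n : ℕ) : (wpart g α n).IsWeightedHomogeneous α n := by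
  intro d hd
  rw [coeff_wpart hα] at hd
  by_contra h
  simp [h] at hd

theorem coe_wpart {α : Fin 2 → ℕ} (hα : ∀ c, 0 < α c) (g : MvPowerSeries (Fin 2) k) (n : ℕ) :
    (wpart g α n : MvPowerSeries (Fin 2) k) = weightedHomogeneousComponent α n g := by
  classical
  ext d
  rw [MvPolynomial.coeff_coe, coeff_wpart hα, coeff_weightedHomogeneousComponent]

theorem wpart_eq_zero_of_lt {α : Fin 2 → ℕ} (hα : ∀ c, 0 < α c) {g : MvPowerSeries (Fin 2) k}
    {n : ℕ} (hn : n < newtonOrder α g) : wpart g α n = 0 := by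
  ext d
  rw [coeff_wpart hα, MvPolynomial.coeff_zero]
  split_ifs with h
  · by_contra hd
    have := newtonOrder_le_weight α hd
    omega
  · rfl

/-- The initial form of a power series with respect to a weight. -/
def initialForm (α : Fin 2 → ℕ) (g : MvPowerSeries (Fin 2) k) : MvPolynomial (Fin 2) k :=
  wpart g α (newtonOrder α g)

theorem isWeightedHomogeneous_initialForm {α : Fin 2 → ℕ} (hα : ∀ c, 0 < α c)
    (g : MvPowerSeries (Fin 2) k) :
    (initialForm α g).IsWeightedHomogeneous α (newtonOrder α g) :=
  isWeightedHomogeneous_wpart hα g _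

theorem initialForm_mul {α : Fin 2 → ℕ} (hα : ∀ c, 0 < α c) {g h : MvPowerSeries (Fin 2) k}
    (hg : g ≠ 0) (hh : h ≠ 0) :
    initialForm α (g * h) = initialForm α g * initialForm α h := by
  apply MvPolynomial.coe_injective
  rw [MvPolynomial.coe_mul, initialForm, initialForm, initialForm, newtonOrder_mul α hg hh,
    coe_wpart hα, coe_wpart hα, coe_wpart hα]
  exact weightedHomogeneousComponent_mul_of_le_weightedOrder
    (weightedOrder_eq_newtonOrder α hg).ge (weightedOrder_eq_newtonOrder α hh).ge

theorem eval_weighted_smul {α : Fin 2 → ℕ} {n : ℕ} {F : MvPolynomial (Fin 2) k}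
    (hF : F.IsWeightedHomogeneous α n) (s : k) (a : Fin 2 → k) :
    MvPolynomial.eval (fun c => s ^ α c * a c) F = s ^ n * MvPolynomial.eval a F := by
  rw [MvPolynomial.eval_eq', MvPolynomial.eval_eq', Finset.mul_sum]
  refine Finset.sum_congr rfl fun d hd => ?_
  rw [← hF (MvPolynomial.mem_support_iff.1 hd), weight_fin_two, Fin.prod_univ_two,
    Fin.prod_univ_two]
  ring

/-- The initial form has at least two terms. -/
def HasEdge (α : Fin 2 → ℕ) (g : MvPowerSeries (Fin 2) k) : Prop :=
  ∃ d e, coeff d g ≠ 0 ∧ coeff e g ≠ 0 ∧ d ≠ e ∧ weight α d = newtonOrder α g ∧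
    weight α e = newtonOrder α g

theorem HasEdge.ne_zero {α : Fin 2 → ℕ} {g : MvPowerSeries (Fin 2) k} (h : HasEdge α g) :
    g ≠ 0 := by
  rintro rfl
  obtain ⟨d, -, hd, -⟩ := h
  simp at hd

theorem HasEdge.exists_lt {α : Fin 2 → ℕ} (hα : ∀ c, 0 < α c) {g : MvPowerSeries (Fin 2) k}
    (h : HasEdge α g) : ∃ d e, coeff d g ≠ 0 ∧ coeff e g ≠ 0 ∧
      weight α d = newtonOrder α g ∧ weight α e = newtonOrder α g ∧ e 0 < d 0 ∧ d 1 < e 1 := by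
  obtain ⟨d, e, hd, he, hne, hwd, hwe⟩ := h
  have key : α 0 * d 0 + α 1 * d 1 = α 0 * e 0 + α 1 * e 1 := by
    rw [← weight_fin_two, ← weight_fin_two, hwd, hwe]
  have h0 := hα 0
  have h1 := hα 1
  rcases lt_trichotomy (d 0) (e 0) with h | h | h
  · refine ⟨e, d, he, hd, hwe, hwd, h, ?_⟩
    by_contra hc
    nlinarith
  · exfalso
    rw [h] at key
    have : d 1 = e 1 := by
      have : α 1 * d 1 = α 1 * e 1 := by omega
      exact Nat.eq_of_mul_eq_mul_left h1 this
    exact hne (Finsupp.ext (Fin.forall_fin_two.2 ⟨h, this⟩))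
  · refine ⟨d, e, hd, he, hwd, hwe, h, ?_⟩
    by_contra hc
    nlinarith

/-- One end of the edge involves `x` and the other involves `y`. The bound ensures that the
coefficients of `w` that the equations up to order `m` determine are all visible in the `m`-jet. -/
theorem HasEdge.le_newtonOrder {α : Fin 2 → ℕ} (hα : ∀ c, 0 < α c) {g : MvPowerSeries (Fin 2) k}
    (h : HasEdge α g) (c : Fin 2) : α c ≤ newtonOrder α g := by
  obtain ⟨d, e, -, -, hd, he, h0, h1⟩ := h.exists_lt hα
  have h2 := Nat.le_mul_of_pos_right (α 0) (show 0 < d 0 by omega)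
  have h3 := Nat.le_mul_of_pos_right (α 1) (show 0 < e 1 by omega)
  rw [weight_fin_two] at hd he
  fin_cases c <;> simp <;> omega

/-- A split polynomial whose only root is `0` is a monomial. -/
theorem _root_.Polynomial.exists_root_ne_zero [IsAlgClosed k] {p : Polynomial k} {i j : ℕ}
    (hij : i ≠ j) (hi : p.coeff i ≠ 0) (hj : p.coeff j ≠ 0) : ∃ b, b ≠ 0 ∧ p.IsRoot b := by
  by_contra! hc
  have hp : p ≠ 0 := by
    rintro rfl
    simp at hi
  have h0 : p.roots = Multiset.replicate (Multiset.card p.roots) 0 := by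
    rw [Multiset.eq_replicate]
    refine ⟨rfl, fun b hb => ?_⟩
    by_contra hb0
    exact hc b hb0 ((Polynomial.mem_roots hp).1 hb)
  have h1 := (IsAlgClosed.splits p).eq_prod_roots
  rw [h0] at h1
  simp only [Multiset.map_replicate, Multiset.prod_replicate, map_zero, sub_zero] at h1
  rw [h1, Polynomial.coeff_C_mul, Polynomial.coeff_X_pow] at hi hj
  have e1 : i = Multiset.card p.roots := by
    by_contra h
    simp [h] at hi
  have e2 : j = Multiset.card p.roots := by
    by_contra h
    simp [h] at hj
  omega

/-- Put `x = 1`. Monomials of equal weight are told apart by their exponent of `y`, so no terms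
merge and at least two survive. -/
theorem HasEdge.exists_torus_root [IsAlgClosed k] {α : Fin 2 → ℕ} (hα : ∀ c, 0 < α c)
    {g : MvPowerSeries (Fin 2) k} (h : HasEdge α g) :
    ∃ a : Fin 2 → k, (∀ c, a c ≠ 0) ∧ MvPolynomial.eval a (initialForm α g) = 0 := by
  obtain ⟨d, e, hd, he, hwd, hwe, -, hlt⟩ := h.exists_lt hα
  set p : Polynomial k := MvPolynomial.aeval ![1, Polynomial.X] (initialForm α g) with hp
  have hsum : p = ∑ x ∈ (initialForm α g).support,
      Polynomial.monomial (x 1) (MvPolynomial.coeff x (initialForm α g)) := by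
    rw [hp, MvPolynomial.aeval_eq_eval₂Hom, MvPolynomial.coe_eval₂Hom, MvPolynomial.eval₂_eq']
    refine Finset.sum_congr rfl fun x _ => ?_
    rw [Fin.prod_univ_two]
    simp [← Polynomial.C_mul_X_pow_eq_monomial]
  have hcoeff : ∀ x : Fin 2 →₀ ℕ, coeff x g ≠ 0 → weight α x = newtonOrder α g →
      p.coeff (x 1) ≠ 0 := by
    intro x hx hwx
    have hx' : MvPolynomial.coeff x (initialForm α g) = coeff x g := by
      rw [initialForm, coeff_wpart hα, if_pos hwx]
    rw [hsum, Polynomial.finsetSum_coeff, Finset.sum_eq_single x]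
    · simpa [hx'] using hx
    · intro y hy hyx
      rw [Polynomial.coeff_monomial, if_neg]
      intro hy1
      apply hyx
      have hwy := isWeightedHomogeneous_wpart hα g _ (MvPolynomial.mem_support_iff.1 hy)
      rw [← hwx, weight_fin_two, weight_fin_two, hy1] at hwy
      have := Nat.eq_of_mul_eq_mul_left (hα 0) (Nat.add_right_cancel hwy)
      exact Finsupp.ext (Fin.forall_fin_two.2 ⟨this, hy1⟩)
    · intro hx2
      rw [MvPolynomial.notMem_support_iff, hx'] at hx2
      exact absurd hx2 hx
  obtain ⟨b, hb, hroot⟩ := Polynomial.exists_root_ne_zero hlt.ne (hcoeff d hd hwd)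
    (hcoeff e he hwe)
  refine ⟨![1, b], Fin.forall_fin_two.2 ⟨by simp, by simpa using hb⟩, ?_⟩
  have h2 : Polynomial.aeval b p = MvPolynomial.aeval ![1, b] (initialForm α g) := by
    rw [hp, ← AlgHom.comp_apply, MvPolynomial.comp_aeval]
    congr 2
    funext c
    fin_cases c <;> simp
  rw [← MvPolynomial.coe_aeval_eq_eval]
  change MvPolynomial.aeval ![1, b] (initialForm α g) = 0
  rw [← h2, Polynomial.coe_aeval_eq_eval]
  exact hroot

end Weights

/-! ### From faces and the tropical variety to initial forms. -/

section Polygon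

variable {k : Type*} [Field k]

/-- The value of a weight on a point of the plane. -/
def weightFunctional (ω : Fin 2 → ℝ) : (Fin 2 → ℝ) →L[ℝ] ℝ :=
  ω 0 • ContinuousLinearMap.proj 0 + ω 1 • ContinuousLinearMap.proj 1

theorem weightFunctional_apply (ω v : Fin 2 → ℝ) :
    weightFunctional ω v = ω 0 * v 0 + ω 1 * v 1 := by
  simp [weightFunctional]

theorem weightFunctional_toPlane (α : Fin 2 → ℕ) (d : Fin 2 →₀ ℕ) :
    weightFunctional (fun c => (α c : ℝ)) (toPlane d) = (weight α d : ℕ) := by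
  rw [weightFunctional_apply, weight_fin_two]
  simp [toPlane]

theorem weightFunctional_mono {ω : Fin 2 → ℝ} (hω : ∀ c, 0 ≤ ω c) {v w : Fin 2 → ℝ}
    (h : v ≤ w) : weightFunctional ω v ≤ weightFunctional ω w := by
  rw [weightFunctional_apply, weightFunctional_apply]
  exact add_le_add (mul_le_mul_of_nonneg_left (h 0) (hω 0))
    (mul_le_mul_of_nonneg_left (h 1) (hω 1))

theorem newtonOrder_cast (α : Fin 2 → ℕ) {g : MvPowerSeries (Fin 2) k} (hg : g ≠ 0) :
    newtonOrder (fun c => (α c : ℝ)) g = (newtonOrder α g : ℕ) := by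
  unfold newtonOrder
  refine IsLeast.csInf_eq ⟨?_, ?_⟩
  · obtain ⟨d, hd, e⟩ := exists_weight_eq_newtonOrder α hg
    refine ⟨d, hd, ?_⟩
    rw [weight_fin_two] at e
    change ((newtonOrder α g : ℕ) : ℝ) = _
    rw [← e]
    push_cast
    rfl
  · rintro r ⟨d, hd, rfl⟩
    have := newtonOrder_le_weight α hd
    rw [weight_fin_two] at this
    change ((newtonOrder α g : ℕ) : ℝ) ≤ (α 0 : ℝ) * (d 0 : ℝ) + (α 1 : ℝ) * (d 1 : ℝ)
    exact_mod_cast this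

theorem weightFunctional_ge_of_mem_newtonRegion (α : Fin 2 → ℕ) {g : MvPowerSeries (Fin 2) k}
    {v : Fin 2 → ℝ} (hv : v ∈ newtonRegion g) :
    ((newtonOrder α g : ℕ) : ℝ) ≤ weightFunctional (fun c => (α c : ℝ)) v := by
  have h : newtonRegion g ⊆ {v | ((newtonOrder α g : ℕ) : ℝ) ≤ weightFunctional (fun c => (α c : ℝ)) v} :=
    convexHull_min (by
      rintro v ⟨d, hd, hdv⟩
      have h1 := weightFunctional_mono (ω := fun c => (α c : ℝ)) (fun c => Nat.cast_nonneg _) hdv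
      rw [weightFunctional_toPlane] at h1
      exact le_trans (by exact_mod_cast newtonOrder_le_weight α hd) h1)
      (convex_halfSpace_ge (weightFunctional _).isLinear _)
  exact h hv

/-- The points of the Newton region of least weight are the convex combinations of the exponents
of least weight. -/
theorem newtonRegion_inter_supportingLine {α : Fin 2 → ℕ} (hα : ∀ c, 0 < α c)
    {g : MvPowerSeries (Fin 2) k} :
    {v ∈ newtonRegion g | weightFunctional (fun c => (α c : ℝ)) v = (newtonOrder α g : ℕ)} =
      convexHull ℝ (toPlane '' {d | coeff d g ≠ 0 ∧ weight α d = newtonOrder α g}) := by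
  apply subset_antisymm
  · rintro v ⟨hv, hvw⟩
    rw [newtonRegion, _root_.convexHull_eq] at hv
    obtain ⟨ι, t, w, z, hw0, hw1, hz, rfl⟩ := hv
    rw [Finset.centerMass_eq_of_sum_1 _ _ hw1] at hvw ⊢
    have hge : ∀ i ∈ t, ((newtonOrder α g : ℕ) : ℝ) ≤ weightFunctional (fun c => (α c : ℝ)) (z i) :=
      fun i hi => weightFunctional_ge_of_mem_newtonRegion α (subset_convexHull ℝ _ (hz i hi))
    have hsum : ∑ i ∈ t, w i * (weightFunctional (fun c => (α c : ℝ)) (z i) - (newtonOrder α g : ℕ))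
        = 0 := by
      rw [map_sum] at hvw
      simp only [map_smul, smul_eq_mul] at hvw
      simp only [mul_sub, Finset.sum_sub_distrib, hvw, ← Finset.sum_mul, hw1]
      ring
    rw [Finset.sum_eq_zero_iff_of_nonneg
      (fun i hi => mul_nonneg (hw0 i hi) (sub_nonneg.2 (hge i hi)))] at hsum
    have hmem : ∀ i ∈ t, w i ≠ 0 →
        z i ∈ toPlane '' {d | coeff d g ≠ 0 ∧ weight α d = newtonOrder α g} := by
      intro i hi hwi
      obtain ⟨d, hd, hdz⟩ := hz i hi
      have h1 := sub_eq_zero.1 ((mul_eq_zero.1 (hsum i hi)).resolve_left hwi)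
      have h2 := newtonOrder_le_weight α hd
      have h3 : (weight α d : ℝ) = weightFunctional (fun c => (α c : ℝ)) (toPlane d) :=
        (weightFunctional_toPlane α d).symm
      have h4 : ((newtonOrder α g : ℕ) : ℝ) ≤ weight α d := by exact_mod_cast h2
      have hα0 : (0 : ℝ) < α 0 := by exact_mod_cast hα 0
      have hα1 : (0 : ℝ) < α 1 := by exact_mod_cast hα 1
      have hz0 := hdz 0
      have hz1 := hdz 1
      rw [weightFunctional_apply] at h1 h3
      have e0 : toPlane d 0 = z i 0 := by
        by_contra hne
        have := lt_of_le_of_ne hz0 hne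
        nlinarith
      have e1 : toPlane d 1 = z i 1 := by
        by_contra hne
        have := lt_of_le_of_ne hz1 hne
        nlinarith
      refine ⟨d, ⟨hd, ?_⟩, funext (Fin.forall_fin_two.2 ⟨e0, e1⟩)⟩
      have : (weight α d : ℝ) = (newtonOrder α g : ℕ) := by rw [h3, e0, e1, h1]
      exact_mod_cast this
    classical
    rw [← Finset.centerMass_eq_of_sum_1 _ _ hw1, ← Finset.centerMass_filter_ne_zero]
    refine Finset.centerMass_mem_convexHull _ (fun i hi => hw0 i (Finset.mem_filter.1 hi).1) ?_
      fun i hi => hmem i (Finset.mem_filter.1 hi).1 (Finset.mem_filter.1 hi).2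
    rw [Finset.sum_filter_ne_zero, hw1]
    exact zero_lt_one
  · refine convexHull_min ?_ ?_
    · rintro _ ⟨d, ⟨hd, hw⟩, rfl⟩
      refine ⟨subset_convexHull ℝ _ ⟨d, hd, le_rfl⟩, ?_⟩
      rw [weightFunctional_toPlane, hw]
    · exact (convex_convexHull ℝ _).inter
        (convex_hyperplane (weightFunctional _).isLinear _)

theorem supportingLine_cast (α : Fin 2 → ℕ) {g : MvPowerSeries (Fin 2) k} (hg : g ≠ 0) :
    supportingLine (fun c => (α c : ℝ)) g =
      {v | weightFunctional (fun c => (α c : ℝ)) v = (newtonOrder α g : ℕ)} := by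
  simp only [supportingLine, newtonOrder_cast α hg, weightFunctional_apply]

theorem hasEdge_of_tropicalVariety_eq_ray {α : Fin 2 → ℕ} (hα : ∀ c, 0 < α c)
    {g : MvPowerSeries (Fin 2) k} (hg : g ≠ 0) (hT : tropicalVariety g = ray α) :
    HasEdge α g := by
  have h : (fun c => (α c : ℝ)) ∈ tropicalVariety g := by
    rw [hT]
    exact ⟨1, zero_le_one, by simp⟩
  obtain ⟨Φ, ⟨hexp, -, -⟩, hnt, -, hline⟩ := h
  rw [supportingLine_cast α hg] at hline
  have hsub : Φ ⊆ convexHull ℝ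
      (toPlane '' {d | coeff d g ≠ 0 ∧ weight α d = newtonOrder α g}) := by
    rw [← newtonRegion_inter_supportingLine hα]
    exact fun v hv => ⟨hexp.subset hv, hline hv⟩
  have hnt' : (toPlane '' {d | coeff d g ≠ 0 ∧ weight α d = newtonOrder α g}).Nontrivial := by
    by_contra hc
    rw [Set.not_nontrivial_iff] at hc
    rcases hc.eq_empty_or_singleton with h | ⟨x, h⟩
    · rw [h, convexHull_empty] at hsub
      exact (hnt.mono hsub).ne_empty rfl
    · rw [h, convexHull_singleton] at hsub
      exact Set.not_nontrivial_singleton (hnt.mono hsub)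
  obtain ⟨_, ⟨d, hd, rfl⟩, _, ⟨e, he, rfl⟩, hne⟩ := hnt'
  exact ⟨d, e, hd.1, he.1, fun h => hne (by rw [h]), hd.2, he.2⟩

theorem isNewtonFace_inter {α : Fin 2 → ℕ} (hα : ∀ c, 0 < α c) {g : MvPowerSeries (Fin 2) k}
    (hg : g ≠ 0) : IsNewtonFace g
      {v ∈ newtonRegion g | weightFunctional (fun c => (α c : ℝ)) v = (newtonOrder α g : ℕ)} := by
  have hne : (toPlane '' {d | coeff d g ≠ 0 ∧ weight α d = newtonOrder α g}).Nonempty := by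
    obtain ⟨d, hd⟩ := exists_weight_eq_newtonOrder α hg
    exact ⟨_, d, hd, rfl⟩
  have hfin : {d | coeff d g ≠ 0 ∧ weight α d = newtonOrder α g}.Finite :=
    (finite_of_nat_weight_le α (fun c => (hα c).ne') (newtonOrder α g)).subset
      fun d hd => hd.2.le
  -- Exposed faces are sets of maximizers, hence the sign.
  refine ⟨fun _ => ⟨-weightFunctional (fun c => (α c : ℝ)), ?_⟩, ?_, ?_⟩
  · ext v
    simp only [Set.mem_ofPred_eq, _root_.neg_apply, neg_le_neg_iff]
    refine and_congr_right fun hv => ⟨fun h w hw => ?_, fun h => ?_⟩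
    · rw [h]
      exact weightFunctional_ge_of_mem_newtonRegion α hw
    · obtain ⟨d, hd, hw⟩ := exists_weight_eq_newtonOrder α hg
      refine le_antisymm ?_ (weightFunctional_ge_of_mem_newtonRegion α hv)
      rw [← hw, ← weightFunctional_toPlane]
      exact h _ (subset_convexHull ℝ _ ⟨d, hd, le_rfl⟩)
  · rw [newtonRegion_inter_supportingLine hα]
    exact convexHull_nonempty_iff.2 hne
  · rw [newtonRegion_inter_supportingLine hα]
    exact (hfin.image _).isCompact_convexHull ℝ

theorem facePart_inter {α : Fin 2 → ℕ} (hα : ∀ c, 0 < α c) (f : MvPolynomial (Fin 2) k) :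
    facePart f {v ∈ newtonRegion (f : MvPowerSeries (Fin 2) k) |
      weightFunctional (fun c => (α c : ℝ)) v =
        (newtonOrder α (f : MvPowerSeries (Fin 2) k) : ℕ)} =
      initialForm α (f : MvPowerSeries (Fin 2) k) := by
  classical
  ext d
  rw [facePart, MvPolynomial.coeff_sum, initialForm, coeff_wpart hα]
  simp only [MvPolynomial.coeff_monomial]
  rw [Finset.sum_ite_eq', MvPolynomial.coeff_coe]
  simp only [Finset.mem_filter, MvPolynomial.mem_support_iff, Set.mem_ofPred_eq,
    weightFunctional_toPlane, Nat.cast_inj]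
  by_cases hd : MvPolynomial.coeff d f = 0
  · simp [hd]
  · have hmem : toPlane d ∈ newtonRegion (f : MvPowerSeries (Fin 2) k) :=
      subset_convexHull ℝ _ ⟨d, by simpa [supp] using hd, le_rfl⟩
    simp [hd, hmem]

theorem IsNewtonPlaneCurve.exists_pderiv_ne_zero {f : MvPolynomial (Fin 2) k}
    (hf : IsNewtonPlaneCurve f) {α : Fin 2 → ℕ} (hα : ∀ c, 0 < α c) {a : Fin 2 → k}
    (ha : ∀ c, a c ≠ 0)
    (h0 : MvPolynomial.eval a (initialForm α (f : MvPowerSeries (Fin 2) k)) = 0) :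
    ∃ c, MvPolynomial.eval a
      (MvPolynomial.pderiv c (initialForm α (f : MvPowerSeries (Fin 2) k))) ≠ 0 := by
  by_contra! hc
  have hf0 : (f : MvPowerSeries (Fin 2) k) ≠ 0 := by
    rw [Ne, MvPolynomial.coe_eq_zero_iff]
    exact hf.squarefree.ne_zero
  refine hf.nondegenerate _ (isNewtonFace_inter hα hf0) ⟨a, ha, ?_⟩
  rw [facePart_inter hα]
  exact ⟨h0, hc⟩

/-- Every exponent of a product dominates an exponent of the first factor. Applied to a unit and its
inverse, this makes the Newton region an invariant of the branch. -/
theorem newtonRegion_mul_subset (g u : MvPowerSeries (Fin 2) k) :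
    newtonRegion (g * u) ⊆ newtonRegion g := by
  classical
  refine convexHull_mono ?_
  rintro v ⟨d, hd, hdv⟩
  rw [supp, Set.mem_ofPred_eq, coeff_mul] at hd
  obtain ⟨⟨x, y⟩, hxy, hne⟩ := Finset.exists_ne_zero_of_sum_ne_zero hd
  rw [Finset.HasAntidiagonal.mem_antidiagonal] at hxy
  refine ⟨x, left_ne_zero_of_mul hne, le_trans (fun c => ?_) hdv⟩
  simp only [toPlane, Nat.cast_le]
  have := DFunLike.congr_fun hxy c
  simp only [Finsupp.add_apply] at this
  omega

theorem Associated.newtonRegion_eq {g h : MvPowerSeries (Fin 2) k} (hgh : Associated g h) :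
    newtonRegion g = newtonRegion h := by
  obtain ⟨u, rfl⟩ := hgh
  refine subset_antisymm ?_ (newtonRegion_mul_subset _ _)
  conv_lhs => rw [← Units.mul_inv_cancel_right g u]
  exact newtonRegion_mul_subset _ _

theorem Associated.supp_dominated {g h : MvPowerSeries (Fin 2) k} (hgh : Associated g h)
    {d : Fin 2 →₀ ℕ} (hd : d ∈ supp g) : ∃ e ∈ supp h, e ≤ d := by
  classical
  obtain ⟨u, rfl⟩ := hgh.symm
  rw [supp, Set.mem_ofPred_eq, coeff_mul] at hd
  obtain ⟨⟨x, y⟩, hxy, hne⟩ := Finset.exists_ne_zero_of_sum_ne_zero hd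
  rw [Finset.HasAntidiagonal.mem_antidiagonal] at hxy
  exact ⟨x, left_ne_zero_of_mul hne, hxy ▸ le_self_add⟩

theorem Associated.newtonOrder_le {g h : MvPowerSeries (Fin 2) k} (hgh : Associated g h)
    (hg : g ≠ 0) {ω : Fin 2 → ℝ} (hω : ∀ c, 0 ≤ ω c) : newtonOrder ω h ≤ newtonOrder ω g := by
  obtain ⟨d0, hd0⟩ := supp_nonempty hg
  refine le_csInf ⟨_, d0, hd0, rfl⟩ ?_
  rintro r ⟨d, hd, rfl⟩
  obtain ⟨e, he, hed⟩ := Associated.supp_dominated hgh hd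
  have hbdd : BddBelow {r | ∃ d ∈ supp h, r = ω 0 * (d 0 : ℝ) + ω 1 * (d 1 : ℝ)} := by
    refine ⟨0, ?_⟩
    rintro r ⟨d, -, rfl⟩
    have := hω 0
    have := hω 1
    positivity
  refine (csInf_le hbdd ⟨e, he, rfl⟩).trans ?_
  · have h0 : (e 0 : ℝ) ≤ d 0 := by exact_mod_cast hed 0
    have h1 : (e 1 : ℝ) ≤ d 1 := by exact_mod_cast hed 1
    exact add_le_add (mul_le_mul_of_nonneg_left h0 (hω 0)) (mul_le_mul_of_nonneg_left h1 (hω 1))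

theorem Associated.tropicalVariety_eq {g h : MvPowerSeries (Fin 2) k} (hgh : Associated g h)
    (hg : g ≠ 0) : tropicalVariety g = tropicalVariety h := by
  have key : ∀ {g h : MvPowerSeries (Fin 2) k}, Associated g h → g ≠ 0 →
      tropicalVariety g ⊆ tropicalVariety h := by
    rintro g h hgh hg ω ⟨Φ, hΦ, hnt, hω, hline⟩
    have hh : h ≠ 0 := hgh.ne_zero_iff.1 hg
    refine ⟨Φ, ?_, hnt, hω, ?_⟩
    · rw [IsNewtonFace, ← Associated.newtonRegion_eq hgh]
      exact hΦ
    · rwa [supportingLine, ← le_antisymm (Associated.newtonOrder_le hgh.symm hh hω)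
        (Associated.newtonOrder_le hgh hg hω)]
  exact subset_antisymm (key hgh hg) (key hgh.symm (hgh.ne_zero_iff.1 hg))

theorem exists_smul_of_ray_eq {α β : Fin 2 → ℕ} (h : ray α = ray β) :
    ∃ s : ℝ, 0 ≤ s ∧ ∀ c, (α c : ℝ) = s * β c := by
  have : (fun c => (α c : ℝ)) ∈ ray β := by
    rw [← h]
    exact ⟨1, zero_le_one, by simp⟩
  exact this

end Polygon

end

end NewtonJets

namespace NewtonJets

open MvPowerSeries Finsupp

noncomputable section

/-! ### Coefficients of a series along an arc, and their first-order variation. -/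

section JetCoeff

variable {k : Type*} [Field k] {R : Type*} [CommRing R] [Algebra k R]

/-- The coefficient of `t ^ N` in `g (t ^ α₁ w₁, t ^ α₂ w₂)`. -/
def jetCoeff (α : Fin 2 → ℕ) (g : MvPowerSeries (Fin 2) k) (N : ℕ) (w : Fin 2 → PowerSeries R) :
    R :=
  ∑ j ∈ Finset.range (N + 1), PowerSeries.coeff (N - j) (MvPolynomial.aeval w (wpart g α j))

theorem coeff_subst_X_pow_mul {α : Fin 2 → ℕ} (hα : ∀ c, 0 < α c) (g : MvPowerSeries (Fin 2) k)
    (N : ℕ) (w : Fin 2 → PowerSeries R) :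
    PowerSeries.coeff N (MvPowerSeries.subst (fun c => PowerSeries.X ^ α c * w c) g :
      PowerSeries R) = jetCoeff α g N w := by
  classical
  have hs : MvPowerSeries.HasSubst (fun c => PowerSeries.X ^ α c * w c) := by
    refine hasSubst_of_constantCoeff_zero fun c => ?_
    change PowerSeries.constantCoeff (PowerSeries.X ^ α c * w c) = 0
    simp [(hα c).ne']
  set S := (finite_of_nat_weight_le α (fun c => (hα c).ne') N).toFinset with hS
  have hmemS : ∀ d, d ∈ S ↔ weight α d ≤ N := fun d => by simp [hS]
  have hprod : ∀ d : Fin 2 →₀ ℕ, (d.prod fun s e => (PowerSeries.X ^ α s * w s) ^ e) =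
      PowerSeries.X ^ weight α d * (w 0 ^ d 0 * w 1 ^ d 1) := by
    intro d
    rw [Finsupp.prod_fintype _ _ (by simp), Fin.prod_univ_two, weight_fin_two]
    ring
  rw [PowerSeries.coeff, MvPowerSeries.coeff_subst hs]
  change ∑ᶠ d, MvPowerSeries.coeff d g • PowerSeries.coeff N
    (d.prod fun s e => (PowerSeries.X ^ α s * w s) ^ e) = _
  rw [finsum_eq_sum_of_support_subset (s := S)]
  · rw [jetCoeff, ← Finset.sum_fiberwise_of_maps_to (g := weight α) (t := Finset.range (N + 1))]
    · refine Finset.sum_congr rfl fun j hj => ?_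
      have hj' : j ≤ N := by simpa [Nat.lt_succ_iff] using hj
      have hw : wpart g α j = ∑ d ∈ S with weight α d = j,
          MvPolynomial.monomial d (MvPowerSeries.coeff d g) := by
        ext d
        rw [coeff_wpart hα, MvPolynomial.coeff_sum]
        simp only [MvPolynomial.coeff_monomial]
        rw [Finset.sum_ite_eq']
        refine if_congr ?_ rfl rfl
        rw [Finset.mem_filter, hmemS]
        omega
      rw [hw, map_sum, map_sum]
      refine Finset.sum_congr rfl fun d hd => ?_
      have hd' := (Finset.mem_filter.1 hd).2
      rw [hprod, PowerSeries.coeff_X_pow_mul', hd', if_pos hj', MvPolynomial.aeval_monomial,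
        Finsupp.prod_fintype _ _ (by simp), Fin.prod_univ_two, ← Algebra.smul_def,
        PowerSeries.coeff_smul]
    · intro d hd
      rw [Finset.mem_range, Nat.lt_succ_iff]
      exact (hmemS d).1 hd
  · intro d hd
    rw [Finset.mem_coe, hmemS]
    by_contra hlt
    rw [Function.mem_support, hprod, PowerSeries.coeff_X_pow_mul', if_neg hlt, smul_zero] at hd
    exact hd rfl

theorem jetCoeff_map {R' : Type*} [CommRing R'] [Algebra k R'] (φ : R →ₐ[k] R') (α : Fin 2 → ℕ)
    (g : MvPowerSeries (Fin 2) k) (N : ℕ) (w : Fin 2 → PowerSeries R) :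
    φ (jetCoeff α g N w) = jetCoeff α g N fun c => PowerSeries.map (φ : R →+* R') (w c) := by
  rw [jetCoeff, jetCoeff, map_sum]
  refine Finset.sum_congr rfl fun j _ => ?_
  have h : MvPolynomial.aeval (fun c => PowerSeries.map (φ : R →+* R') (w c)) (wpart g α j) =
      PowerSeries.map (φ : R →+* R') (MvPolynomial.aeval w (wpart g α j)) := by
    induction wpart g α j using MvPolynomial.induction_on with
    | C r =>
      simp only [MvPolynomial.aeval_C]
      rw [PowerSeries.algebraMap_apply, PowerSeries.algebraMap_apply, PowerSeries.map_C]
      simp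
    | add p q hp hq => rw [map_add, map_add, map_add, hp, hq]
    | mul_X p c hp =>
      rw [map_mul, map_mul, map_mul, hp, MvPolynomial.aeval_X, MvPolynomial.aeval_X]
  rw [h, PowerSeries.coeff_map]
  rfl

theorem coeff_mul_of_coeff_lt_eq_zero {δ : PowerSeries R} {n : ℕ}
    (hδ : ∀ j < n, PowerSeries.coeff j δ = 0) (p : PowerSeries R) :
    (∀ j < n, PowerSeries.coeff j (δ * p) = 0) ∧
      PowerSeries.coeff n (δ * p) = PowerSeries.coeff n δ * PowerSeries.constantCoeff p := by
  obtain ⟨q, rfl⟩ := PowerSeries.X_pow_dvd_iff.2 hδ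
  rw [mul_assoc]
  refine ⟨fun j hj => ?_, ?_⟩
  · rw [PowerSeries.coeff_X_pow_mul', if_neg (by omega)]
  · rw [PowerSeries.coeff_X_pow_mul', PowerSeries.coeff_X_pow_mul']
    simp

theorem coeff_aeval_sub_eq_zero {w w' : Fin 2 → PowerSeries R} {n : ℕ}
    (h : ∀ c, ∀ j < n, PowerSeries.coeff j (w c) = PowerSeries.coeff j (w' c))
    (F : MvPolynomial (Fin 2) k) (j : ℕ) (hj : j < n) :
    PowerSeries.coeff j (MvPolynomial.aeval w F) =
      PowerSeries.coeff j (MvPolynomial.aeval w' F) := by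
  induction F using MvPolynomial.induction_on generalizing j with
  | C r => simp
  | add p q hp hq => rw [map_add, map_add, map_add, map_add, hp j hj, hq j hj]
  | mul_X p c hp =>
    rw [map_mul (MvPolynomial.aeval w), map_mul (MvPolynomial.aeval w'), MvPolynomial.aeval_X,
      MvPolynomial.aeval_X, PowerSeries.coeff_mul, PowerSeries.coeff_mul]
    refine Finset.sum_congr rfl fun x hx => ?_
    rw [Finset.HasAntidiagonal.mem_antidiagonal] at hx
    rw [hp x.1 (by omega), h c x.2 (by omega)]

/-- Taylor's formula to first order, for the coefficient of `t ^ n`. -/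
theorem coeff_aeval_sub {w w' : Fin 2 → PowerSeries R} {n : ℕ} (hn : 0 < n)
    (h : ∀ c, ∀ j < n, PowerSeries.coeff j (w c) = PowerSeries.coeff j (w' c))
    (F : MvPolynomial (Fin 2) k) :
    PowerSeries.coeff n (MvPolynomial.aeval w F) - PowerSeries.coeff n (MvPolynomial.aeval w' F) =
      ∑ c, MvPolynomial.aeval (fun c => PowerSeries.constantCoeff (w c)) (MvPolynomial.pderiv c F) *
        (PowerSeries.coeff n (w c) - PowerSeries.coeff n (w' c)) := by
  have hconst : ∀ G : MvPolynomial (Fin 2) k, PowerSeries.constantCoeff (MvPolynomial.aeval w' G) =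
      MvPolynomial.aeval (fun c => PowerSeries.constantCoeff (w c)) G := by
    intro G
    rw [← PowerSeries.coeff_zero_eq_constantCoeff_apply, ← coeff_aeval_sub_eq_zero h G 0 hn,
      PowerSeries.coeff_zero_eq_constantCoeff_apply]
    induction G using MvPolynomial.induction_on with
    | C r => simp [PowerSeries.algebraMap_apply]
    | add p q hp hq => simp only [map_add, hp, hq]
    | mul_X p c hp => simp only [map_mul, MvPolynomial.aeval_X, hp]
  induction F using MvPolynomial.induction_on with
  | C r => simp
  | add p q hp hq =>
    simp only [map_add, add_mul, Finset.sum_add_distrib, ← hp, ← hq]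
    ring
  | mul_X p c hp =>
    have e : MvPolynomial.aeval w p * w c - MvPolynomial.aeval w' p * w' c =
        (MvPolynomial.aeval w p - MvPolynomial.aeval w' p) * w c +
          (w c - w' c) * MvPolynomial.aeval w' p := by ring
    have h1 := (coeff_mul_of_coeff_lt_eq_zero (δ := MvPolynomial.aeval w p - MvPolynomial.aeval w' p)
      (n := n) (fun j hj => by rw [map_sub, coeff_aeval_sub_eq_zero h p j hj, sub_self]) (w c)).2
    have h2 := (coeff_mul_of_coeff_lt_eq_zero (δ := w c - w' c)
      (n := n) (fun j hj => by rw [map_sub, h c j hj, sub_self]) (MvPolynomial.aeval w' p)).2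
    rw [← map_sub, map_mul, map_mul, MvPolynomial.aeval_X, MvPolynomial.aeval_X, e, map_add, h1, h2,
      map_sub, hp, map_sub, hconst]
    have hX : ∀ i : Fin 2, MvPolynomial.pderiv i (p * MvPolynomial.X c) =
        MvPolynomial.pderiv i p * MvPolynomial.X c + if i = c then p else 0 := by
      intro i
      rw [MvPolynomial.pderiv_mul, MvPolynomial.pderiv_X, Pi.single_apply]
      simp [eq_comm]
    simp only [hX, map_add, map_mul, MvPolynomial.aeval_X, add_mul, Finset.sum_add_distrib,
      Finset.sum_mul]
    congr 1
    · exact Finset.sum_congr rfl fun i _ => by ring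
    · simp only [apply_ite (MvPolynomial.aeval _), map_zero, ite_mul, zero_mul,
        Finset.sum_ite_eq', Finset.mem_univ, if_true]
      ring

theorem jetCoeff_eq_zero_of_lt {α : Fin 2 → ℕ} (hα : ∀ c, 0 < α c) {g : MvPowerSeries (Fin 2) k}
    {N : ℕ} (hN : N < newtonOrder α g) (w : Fin 2 → PowerSeries R) : jetCoeff α g N w = 0 := by
  refine Finset.sum_eq_zero fun j hj => ?_
  rw [Finset.mem_range] at hj
  rw [wpart_eq_zero_of_lt hα (by omega), map_zero, map_zero]

/-- Separates the initial form, which alone sees the `n`-th coefficients of `w`, from the parts of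
higher weight, which only involve coefficients of lower index. -/
theorem jetCoeff_add_eq {α : Fin 2 → ℕ} (hα : ∀ c, 0 < α c) (g : MvPowerSeries (Fin 2) k)
    (n : ℕ) (w : Fin 2 → PowerSeries R) :
    jetCoeff α g (newtonOrder α g + n) w = PowerSeries.coeff n (MvPolynomial.aeval w
      (initialForm α g)) + ∑ j ∈ Finset.range n, PowerSeries.coeff (n - (j + 1))
        (MvPolynomial.aeval w (wpart g α (newtonOrder α g + (j + 1)))) := by
  rw [jetCoeff, add_assoc, Finset.sum_range_add, Finset.sum_eq_zero, zero_add,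
    Finset.sum_range_succ', add_comm]
  · simp only [Nat.add_sub_add_left, Nat.add_sub_cancel_left, add_zero, initialForm]
  · intro j hj
    rw [Finset.mem_range] at hj
    rw [wpart_eq_zero_of_lt hα hj, map_zero, map_zero]

theorem jetCoeff_newtonOrder {α : Fin 2 → ℕ} (hα : ∀ c, 0 < α c) (g : MvPowerSeries (Fin 2) k)
    (w : Fin 2 → PowerSeries R) : jetCoeff α g (newtonOrder α g) w =
      MvPolynomial.aeval (fun c => PowerSeries.constantCoeff (w c)) (initialForm α g) := by
  have h := jetCoeff_add_eq hα g 0 w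
  rw [add_zero, Finset.sum_range_zero, add_zero] at h
  rw [h]
  induction initialForm α g using MvPolynomial.induction_on with
  | C r => simp [PowerSeries.algebraMap_apply]
  | add p q hp hq => simp only [map_add, hp, hq]
  | mul_X p c hp =>
    rw [PowerSeries.coeff_zero_eq_constantCoeff_apply] at hp ⊢
    simp only [map_mul, MvPolynomial.aeval_X, hp]

theorem jetCoeff_congr {α : Fin 2 → ℕ} (hα : ∀ c, 0 < α c) (g : MvPowerSeries (Fin 2) k)
    {w w' : Fin 2 → PowerSeries R} {n : ℕ}
    (h : ∀ c, ∀ j ≤ n, PowerSeries.coeff j (w c) = PowerSeries.coeff j (w' c)) :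
    jetCoeff α g (newtonOrder α g + n) w = jetCoeff α g (newtonOrder α g + n) w' := by
  rw [jetCoeff_add_eq hα, jetCoeff_add_eq hα]
  have h' : ∀ c, ∀ j < n + 1, PowerSeries.coeff j (w c) = PowerSeries.coeff j (w' c) :=
    fun c j hj => h c j (by omega)
  rw [coeff_aeval_sub_eq_zero h' _ n (by omega)]
  congr 1
  refine Finset.sum_congr rfl fun j hj => ?_
  rw [Finset.mem_range] at hj
  rw [coeff_aeval_sub_eq_zero h' _ (n - (j + 1)) (by omega)]

/-- The parts of higher weight cancel in the difference, and Taylor's formula applies to the initial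
form. The Hensel lifting and the dimension count both rest on this identity. -/
theorem jetCoeff_sub {α : Fin 2 → ℕ} (hα : ∀ c, 0 < α c) (g : MvPowerSeries (Fin 2) k)
    {w w' : Fin 2 → PowerSeries R} {n : ℕ} (hn : 0 < n)
    (h : ∀ c, ∀ j < n, PowerSeries.coeff j (w c) = PowerSeries.coeff j (w' c)) :
    jetCoeff α g (newtonOrder α g + n) w - jetCoeff α g (newtonOrder α g + n) w' =
      ∑ c, MvPolynomial.aeval (fun c => PowerSeries.constantCoeff (w c))
          (MvPolynomial.pderiv c (initialForm α g)) *
        (PowerSeries.coeff n (w c) - PowerSeries.coeff n (w' c)) := by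
  rw [jetCoeff_add_eq hα, jetCoeff_add_eq hα, ← coeff_aeval_sub hn h]
  rw [Finset.sum_congr rfl fun j hj => coeff_aeval_sub_eq_zero h _ (n - (j + 1))
    (by rw [Finset.mem_range] at hj; omega)]
  ring

end JetCoeff

/-! ### Hensel lifting of a smooth torus zero of the initial form. -/

section Lifting

variable {k : Type*} [Field k]

theorem aeval_self_apply {σ : Type*} (a : σ → k) (F : MvPolynomial σ k) :
    MvPolynomial.aeval a F = MvPolynomial.eval a F := by
  rw [← MvPolynomial.coe_aeval_eq_eval]
  rfl

/-- Hensel's lemma: the coefficients of one of the two series can be solved for, up to order `K`,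
and are arbitrary after that. -/
theorem exists_lift {α : Fin 2 → ℕ} (hα : ∀ c, 0 < α c) (g : MvPowerSeries (Fin 2) k) (c : Fin 2)
    (w : Fin 2 → PowerSeries k)
    (hc : MvPolynomial.eval (fun i => PowerSeries.constantCoeff (w i))
      (MvPolynomial.pderiv c (initialForm α g)) ≠ 0) (τ : ℕ → k) (K : ℕ) :
    ∃ w' : Fin 2 → PowerSeries k, (∀ i ≠ c, w' i = w i) ∧
      (∀ n, n = 0 ∨ K < n → PowerSeries.coeff n (w' c) = PowerSeries.coeff n (w c)) ∧
      ∀ n, 0 < n → n ≤ K → jetCoeff α g (newtonOrder α g + n) w' = τ n := by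
  induction K with
  | zero => exact ⟨w, fun _ _ => rfl, fun _ _ => rfl, fun n h1 h2 => by omega⟩
  | succ K ih =>
    obtain ⟨w₁, h1, h2, h3⟩ := ih
    set D := MvPolynomial.eval (fun i => PowerSeries.constantCoeff (w i))
      (MvPolynomial.pderiv c (initialForm α g)) with hD
    -- By `jetCoeff_sub`, adding `r t ^ (K + 1)` to `w₁ c` changes the coefficient of order `ν + K +
    -- 1` by exactly `D r` and leaves the earlier ones alone.
    set r := (τ (K + 1) - jetCoeff α g (newtonOrder α g + (K + 1)) w₁) / D with hr
    set w₂ : Fin 2 → PowerSeries k := Function.update w₁ c (w₁ c + PowerSeries.monomial (K + 1) r)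
      with hw₂
    have hw₂i : ∀ i ≠ c, w₂ i = w₁ i := fun i hi => by rw [hw₂, Function.update_of_ne hi]
    have hw₂c : w₂ c = w₁ c + PowerSeries.monomial (K + 1) r := by rw [hw₂, Function.update_self]
    have hcoeff : ∀ n, n ≠ K + 1 → ∀ i, PowerSeries.coeff n (w₂ i) = PowerSeries.coeff n (w₁ i) := by
      intro n hn i
      by_cases hi : i = c
      · rw [hi, hw₂c, map_add, PowerSeries.coeff_monomial, if_neg hn, add_zero]
      · rw [hw₂i i hi]
    refine ⟨w₂, fun i hi => by rw [hw₂i i hi, h1 i hi], fun n hn => ?_, fun n hn0 hn => ?_⟩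
    · rw [hcoeff n (by omega), h2 n (by omega)]
    · rcases Nat.lt_or_ge n (K + 1) with hlt | hge
      · rw [jetCoeff_congr hα g (w' := w₁) fun i j hj => hcoeff j (by omega) i]
        exact h3 n hn0 (by omega)
      · obtain rfl : n = K + 1 := by omega
        have hconst : (fun i => PowerSeries.constantCoeff (w₂ i)) =
            fun i => PowerSeries.constantCoeff (w i) := by
          funext i
          rw [← PowerSeries.coeff_zero_eq_constantCoeff_apply, hcoeff 0 (by omega) i]
          by_cases hi : i = c
          · rw [hi, h2 0 (Or.inl rfl), PowerSeries.coeff_zero_eq_constantCoeff_apply]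
          · rw [h1 i hi, PowerSeries.coeff_zero_eq_constantCoeff_apply]
        have hsub := jetCoeff_sub hα g (w := w₂) (w' := w₁) hn0
          fun i j hj => hcoeff j (by omega) i
        rw [hconst, Finset.sum_eq_single c] at hsub
        · rw [hw₂c, map_add, PowerSeries.coeff_monomial_same, add_sub_cancel_left,
            aeval_self_apply, ← hD, hr, mul_div_cancel₀ _ hc, sub_left_inj] at hsub
          exact hsub
        · intro i _ hi
          rw [hw₂i i hi, sub_self, mul_zero]
        · simp

/-- The solution of Hensel's lemma to all orders. -/
theorem exists_lift_infinite {α : Fin 2 → ℕ} (hα : ∀ c, 0 < α c) (g : MvPowerSeries (Fin 2) k)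
    (c : Fin 2) (w : Fin 2 → PowerSeries k)
    (h0 : MvPolynomial.eval (fun i => PowerSeries.constantCoeff (w i)) (initialForm α g) = 0)
    (hc : MvPolynomial.eval (fun i => PowerSeries.constantCoeff (w i))
      (MvPolynomial.pderiv c (initialForm α g)) ≠ 0) :
    ∃ w' : Fin 2 → PowerSeries k, (∀ i ≠ c, w' i = w i) ∧ ∀ N, jetCoeff α g N w' = 0 := by
  choose v hv1 hv2 hv3 using exists_lift hα g c w hc fun _ => 0
  have hconst : ∀ K i, PowerSeries.constantCoeff (v K i) = PowerSeries.constantCoeff (w i) := by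
    intro K i
    by_cases hi : i = c
    · rw [hi, ← PowerSeries.coeff_zero_eq_constantCoeff_apply, hv2 K 0 (Or.inl rfl),
        PowerSeries.coeff_zero_eq_constantCoeff_apply]
    · rw [hv1 K i hi]
  -- The finite solutions are compatible: each new coefficient is determined by a linear equation
  -- with nonzero factor. Their diagonal is then a solution to all orders.
  have huniq : ∀ n K L, n ≤ K → n ≤ L → ∀ i,
      PowerSeries.coeff n (v K i) = PowerSeries.coeff n (v L i) := by
    intro n
    induction n using Nat.strong_induction_on with
    | _ n ih =>
      intro K L hK hL i
      rcases Nat.eq_zero_or_pos n with rfl | hn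
      · rw [PowerSeries.coeff_zero_eq_constantCoeff_apply,
          PowerSeries.coeff_zero_eq_constantCoeff_apply, hconst, hconst]
      · by_cases hi : i = c
        · have hsub := jetCoeff_sub hα g (w := v K) (w' := v L) hn
            fun i j hj => ih j hj K L (by omega) (by omega) i
          rw [hv3 K n hn hK, hv3 L n hn hL, sub_self, Finset.sum_eq_single c] at hsub
          · simp only [hconst] at hsub
            rw [hi]
            exact sub_eq_zero.1 ((mul_eq_zero.1 hsub.symm).resolve_left hc)
          · intro i _ hi
            rw [hv1 K i hi, hv1 L i hi, sub_self, mul_zero]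
          · simp
        · rw [hv1 K i hi, hv1 L i hi]
  set u : Fin 2 → PowerSeries k := fun i => PowerSeries.mk fun n => PowerSeries.coeff n (v n i)
    with hu
  have hucoeff : ∀ K n, n ≤ K → ∀ i, PowerSeries.coeff n (u i) = PowerSeries.coeff n (v K i) := by
    intro K n hn i
    rw [hu, PowerSeries.coeff_mk]
    exact huniq n n K le_rfl hn i
  refine ⟨u, fun i hi => ?_, fun N => ?_⟩
  · ext n
    rw [hucoeff n n le_rfl, hv1 n i hi]
  · rcases Nat.lt_or_ge N (newtonOrder α g) with hlt | hge
    · exact jetCoeff_eq_zero_of_lt hα hlt u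
    · obtain ⟨n, rfl⟩ := Nat.exists_eq_add_of_le hge
      rw [jetCoeff_congr hα g (w' := v n) fun i j hj => hucoeff n j hj i]
      rcases Nat.eq_zero_or_pos n with rfl | hn
      · rw [add_zero, jetCoeff_newtonOrder hα, aeval_self_apply]
        simp only [hconst]
        exact h0
      · exact hv3 n n hn le_rfl

end Lifting

end

end NewtonJets

namespace NewtonJets

open MvPowerSeries Finsupp

noncomputable section

/-! ### Factoriality of `k[[x, y]]`. -/

section Factorial

variable {k : Type*} [Field k]

/-- The ring is `R[[y]]` with `R = k[[x]]` a principal ideal domain, and power series over such a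
ring are factorial. -/
theorem uniqueFactorizationMonoid_mvPowerSeries_fin_two :
    UniqueFactorizationMonoid (MvPowerSeries (Fin 2) k) := by
  let e : PowerSeries k ≃ₐ[k] MvPowerSeries (Fin 1) k :=
    MvPowerSeries.renameEquiv k (Equiv.ofUnique Unit (Fin 1))
  have : IsPrincipalIdealRing (MvPowerSeries (Fin 1) k) :=
    IsPrincipalIdealRing.of_surjective (e : PowerSeries k →+* MvPowerSeries (Fin 1) k) e.surjective
  have : IsDomain (MvPowerSeries (Fin 1) k) := NoZeroDivisors.to_isDomain _
  exact (MvPowerSeries.finSuccEquiv k 1).symm.toMulEquiv.uniqueFactorizationMonoid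
    inferInstance

theorem prime_of_irreducible {g : MvPowerSeries (Fin 2) k} (hg : Irreducible g) : Prime g := by
  have := uniqueFactorizationMonoid_mvPowerSeries_fin_two (k := k)
  exact UniqueFactorizationMonoid.irreducible_iff_prime.1 hg

end Factorial

/-! ### Series vanishing along a smooth arc. -/

section SmoothArc

variable {k : Type*} [Field k]

/-- If a power series vanishes along the arc `x_o = t`, `x_c = φ (t)`, it is divisible by
`x_c - φ (x_o)`. -/
theorem sub_subst_dvd {c o : Fin 2} (hco : o ≠ c) {φ : PowerSeries k}
    (hφ : PowerSeries.constantCoeff φ = 0) {g : MvPowerSeries (Fin 2) k}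
    (hg : (MvPowerSeries.subst (fun i => if i = c then φ else PowerSeries.X) g :
      PowerSeries k) = 0) :
    (X c - PowerSeries.subst (X o : MvPowerSeries (Fin 2) k) φ) ∣ g := by
  have hX : PowerSeries.HasSubst (X o : MvPowerSeries (Fin 2) k) := PowerSeries.HasSubst.X o
  set ψ : MvPowerSeries (Fin 2) k := PowerSeries.subst (X o : MvPowerSeries (Fin 2) k) φ with hψ
  have hψ0 : constantCoeff ψ = 0 :=
    PowerSeries.constantCoeff_subst_eq_zero (constantCoeff_X o) φ hφ
  have hother : ∀ i, i ≠ c → i = o := by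
    intro i hi
    fin_cases i <;> fin_cases c <;> fin_cases o <;> simp_all
  -- The automorphism `p`, with inverse `q`, straightens the arc to the axis `x_c = 0`, and `r` is
  -- restriction to that axis. Divisibility by `x_c` is then transported back by `q`.
  let p : Fin 2 → MvPowerSeries (Fin 2) k := fun i => if i = c then X c + ψ else X o
  let q : Fin 2 → MvPowerSeries (Fin 2) k := fun i => if i = c then X c - ψ else X o
  let r : Fin 2 → PowerSeries k := fun i => if i = c then 0 else PowerSeries.X
  have hp : HasSubst p := hasSubst_of_constantCoeff_zero fun i => by
    by_cases hi : i = c <;> simp [p, hi, hψ0]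
  have hq : HasSubst q := hasSubst_of_constantCoeff_zero fun i => by
    by_cases hi : i = c <;> simp [q, hi, hψ0]
  have hr : HasSubst r := hasSubst_of_constantCoeff_zero fun i => by
    by_cases hi : i = c
    · simp [r, hi]
    · simp only [r, hi, if_false]
      exact PowerSeries.constantCoeff_X
  have hqo : subst q (X o : MvPowerSeries (Fin 2) k) = X o := by
    rw [subst_X hq]; simp [q, hco]
  have hqψ : subst q ψ = ψ := by
    change subst q (subst (fun _ : Unit => X o) φ) = subst (fun _ : Unit => X o) φ
    rw [subst_comp_subst_apply hX.const hq, hqo]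
  have hqp : subst q (subst p g) = g := by
    rw [subst_comp_subst_apply hp hq]
    have : (fun i => subst q (p i)) = X := by
      funext i
      by_cases hi : i = c
      · simp only [p, hi, if_true]
        rw [subst_add hq, hqψ, subst_X hq]
        simp [q]
      · simp only [p, hi, if_false]
        rw [hqo, hother i hi]
    rw [this, subst_self]
    rfl
  have hrψ : subst r ψ = φ := by
    rw [hψ, PowerSeries.subst, subst_comp_subst_apply hX.const hr]
    have : (fun _ : Unit => subst r (X o : MvPowerSeries (Fin 2) k)) =
        (X : Unit → MvPowerSeries Unit k) := by
      funext u
      rw [subst_X hr]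
      simp only [r, hco, if_false]
      rfl
    rw [this, subst_self]
    rfl
  have hrp : subst r (subst p g) = 0 := by
    rw [subst_comp_subst_apply hp hr, ← hg]
    congr 1
    funext i
    by_cases hi : i = c
    · simp only [p, hi, if_true]
      rw [subst_add hr, hrψ, subst_X hr]
      simp [r]
    · simp only [p, hi, if_false]
      rw [subst_X hr]
      simp [r, hco]
  have hdvd : X c ∣ subst p g := by
    have huniv : (Finset.univ : Finset (Fin 2)) = {c, o} := by
      ext i
      simpa [or_iff_not_imp_left] using hother i
    rw [X_dvd_iff]
    intro d hd
    have h1 := congrArg (PowerSeries.coeff (d o)) hrp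
    rw [PowerSeries.coeff, coeff_subst hr, finsum_eq_single _ d] at h1
    · have : (d.prod fun s e => r s ^ e) = PowerSeries.X ^ d o := by
        rw [Finsupp.prod_fintype _ _ (by simp), huniv, Finset.prod_pair hco.symm]
        simp [r, hco, hd]
      rw [this] at h1
      change MvPowerSeries.coeff d (subst p g) • PowerSeries.coeff (d o) (PowerSeries.X ^ d o) = 0
        at h1
      simpa [PowerSeries.coeff_X_pow_self] using h1
    · intro e he
      have : (e.prod fun s e => r s ^ e) = 0 ^ e c * PowerSeries.X ^ e o := by
        rw [Finsupp.prod_fintype _ _ (by simp), huniv, Finset.prod_pair hco.symm]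
        simp [r, hco]
      rw [this]
      change MvPowerSeries.coeff e (subst p g) • PowerSeries.coeff (d o)
        (0 ^ e c * PowerSeries.X ^ e o) = 0
      by_cases hec : e c = 0
      · have heo : e o ≠ d o := by
          intro h
          apply he
          ext i
          by_cases hi : i = c
          · rw [hi, hec, hd]
          · rw [hother i hi, h]
        rw [hec, pow_zero, one_mul, PowerSeries.coeff_X_pow, if_neg heo.symm, smul_zero]
      · rw [zero_pow hec, zero_mul, map_zero, smul_zero]
  obtain ⟨h, hh⟩ := hdvd
  rw [← hqp, hh, subst_mul hq, subst_X hq]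
  simp only [q, if_true]
  exact dvd_mul_right _ _

theorem coeff_single_one_mul (c : Fin 2) {v : MvPowerSeries (Fin 2) k} (u : MvPowerSeries (Fin 2) k)
    (hv : constantCoeff v = 0) :
    coeff (single c 1) (v * u) = coeff (single c 1) v * constantCoeff u := by
  classical
  rw [coeff_mul, Finset.sum_eq_single (single c 1, 0)]
  · simp
  · rintro ⟨x, y⟩ hxy hne
    replace hxy : x + y = single c 1 :=
      Finset.HasAntidiagonal.mem_antidiagonal.1 hxy
    have hx : x = 0 ∨ x = single c 1 := by
      have hle : x ≤ single c 1 := hxy ▸ le_self_add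
      by_cases hxc : x c = 0
      · left
        ext i
        have := hle i
        by_cases hi : i = c
        · rw [hi, hxc]; rfl
        · rw [single_apply, if_neg (Ne.symm hi)] at this
          simpa using this
      · right
        ext i
        have := hle i
        by_cases hi : i = c
        · subst hi
          simp at this ⊢
          omega
        · rw [single_apply, if_neg (Ne.symm hi)] at this ⊢
          omega
    rcases hx with rfl | rfl
    · simp [hv]
    · exfalso
      apply hne
      rw [add_eq_left] at hxy
      rw [hxy]
  · intro hmem
    simp at hmem

/-- An irreducible power series without linear part does not vanish along a smooth arc. -/
theorem subst_ne_zero_of_irreducible {c o : Fin 2} (hco : o ≠ c) {φ : PowerSeries k}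
    (hφ : PowerSeries.constantCoeff φ = 0) {g : MvPowerSeries (Fin 2) k} (hg : Irreducible g)
    (hlin : coeff (single c 1) g = 0) :
    (MvPowerSeries.subst (fun i => if i = c then φ else PowerSeries.X) g : PowerSeries k) ≠ 0 := by
  classical
  intro h
  obtain ⟨u, hu⟩ := sub_subst_dvd hco hφ h
  set ψ : MvPowerSeries (Fin 2) k := PowerSeries.subst (X o : MvPowerSeries (Fin 2) k) φ with hψ
  have hX : PowerSeries.HasSubst (X o : MvPowerSeries (Fin 2) k) := PowerSeries.HasSubst.X o
  have hψ0 : constantCoeff ψ = 0 :=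
    PowerSeries.constantCoeff_subst_eq_zero (constantCoeff_X o) φ hφ
  have hψ1 : coeff (single c 1) ψ = 0 := by
    rw [hψ, PowerSeries.coeff_subst hX, finsum_eq_zero_of_forall_eq_zero]
    intro d
    rw [coeff_X_pow, if_neg, smul_zero]
    intro h
    have := DFunLike.congr_fun h c
    simp [hco.symm] at this
  have hunit : IsUnit u := by
    refine (hg.isUnit_or_isUnit hu).resolve_left fun hl => ?_
    have := (hl.map constantCoeff).ne_zero
    simp [hψ0] at this
  have hcoeff : coeff (single c 1) g = constantCoeff u := by
    rw [hu, coeff_single_one_mul c u (by simp [hψ0]), map_sub, hψ1]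
    simp [coeff_X]
  rw [hlin] at hcoeff
  exact (hunit.map constantCoeff).ne_zero hcoeff.symm

end SmoothArc

end

end NewtonJets

namespace NewtonJets

open MvPowerSeries Finsupp

noncomputable section

/-! ### The bound `ν_α(g) > α_0 + α_1` for a singular branch. -/

section Order

variable {k : Type*} [Field k]

/-- The initial form is smooth along its zeros in the torus. -/
def Nondegenerate (α : Fin 2 → ℕ) (g : MvPowerSeries (Fin 2) k) : Prop :=
  ∀ a : Fin 2 → k, (∀ c, a c ≠ 0) → MvPolynomial.eval a (initialForm α g) = 0 →
    ∃ c, MvPolynomial.eval a (MvPolynomial.pderiv c (initialForm α g)) ≠ 0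

/-- With `α_o = 1`, a torus zero of the initial form lifts to an arc `x_o = t`, `x_c = φ(t)` on `g =
0`. An irreducible `g` containing such an arc has a nonzero linear part. -/
theorem not_irreducible_of_weight_eq_one [IsAlgClosed k] {α : Fin 2 → ℕ} (hα : ∀ c, 0 < α c)
    {g : MvPowerSeries (Fin 2) k} (hE : HasEdge α g) (hN : Nondegenerate α g)
    (hlin : ∀ c, coeff (single c 1) g = 0) {o : Fin 2} (ho : α o = 1) : ¬ Irreducible g := by
  intro hg
  obtain ⟨c, hco⟩ : ∃ c, o ≠ c := ⟨o + 1, by fin_cases o <;> simp⟩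
  obtain ⟨a, ha, ha0⟩ := hE.exists_torus_root hα
  -- The weighted torus action moves the zero to one with `b o = 1`, so that the arc has exactly
  -- `x_o = t`.
  set b : Fin 2 → k := fun i => (a o)⁻¹ ^ α i * a i with hb
  have hbo : b o = 1 := by simp [hb, ho, ha o]
  have hb0 : MvPolynomial.eval b (initialForm α g) = 0 := by
    rw [hb, eval_weighted_smul (isWeightedHomogeneous_initialForm hα g), ha0, mul_zero]
  obtain ⟨i, hi⟩ := hN b (fun i => mul_ne_zero (pow_ne_zero _ (inv_ne_zero (ha o))) (ha i)) hb0
  have hother : ∀ i, i ≠ c → i = o := by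
    intro i hi
    fin_cases i <;> fin_cases c <;> fin_cases o <;> simp_all
  have huniv : (Finset.univ : Finset (Fin 2)) = {c, o} := by
    ext i
    simpa [or_iff_not_imp_left] using hother i
  -- If the derivative in `x_c` vanished, Euler's relation would make the other one vanish too; its
  -- factor is `α_o b_o = 1`, so the characteristic plays no role.
  have hc : MvPolynomial.eval b (MvPolynomial.pderiv c (initialForm α g)) ≠ 0 := by
    intro hc
    have hEuler := congrArg (MvPolynomial.eval b)
      (isWeightedHomogeneous_initialForm hα g).sum_weight_X_mul_pderiv
    rw [huniv, Finset.sum_pair hco.symm, map_add, map_nsmul, map_nsmul, map_nsmul, map_mul,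
      map_mul, hc, hb0, ho, MvPolynomial.eval_X, MvPolynomial.eval_X, hbo] at hEuler
    have ho0 : MvPolynomial.eval b (MvPolynomial.pderiv o (initialForm α g)) = 0 := by
      simpa using hEuler
    by_cases hic : i = c
    · rw [hic] at hi
      exact hi hc
    · rw [hother i hic] at hi
      exact hi ho0
  have hconst : (fun i => PowerSeries.constantCoeff (PowerSeries.C (b i))) = b := by
    funext i
    simp
  obtain ⟨w, hw1, hw2⟩ := exists_lift_infinite hα g c (fun i => PowerSeries.C (b i))
    (by rw [hconst]; exact hb0) (by rw [hconst]; exact hc)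
  refine subst_ne_zero_of_irreducible (φ := PowerSeries.X ^ α c * w c) hco
    (by simp [(hα c).ne']) hg (hlin c) ?_
  have hfun : (fun i => if i = c then PowerSeries.X ^ α c * w c else PowerSeries.X) =
      fun i => PowerSeries.X ^ α i * w i := by
    funext i
    by_cases hi : i = c
    · rw [if_pos hi, hi]
    · rw [if_neg hi, hw1 i hi, hother i hi, ho, hbo]
      simp
  rw [hfun]
  ext N
  rw [coeff_subst_X_pow_mul hα, hw2, map_zero]

/-- Reduce to a primitive weight `(p, q)`. Neither entry is `1`, by the previous lemma, so `p` and
`q` are distinct and at least `2`, whence `p + q < p q`. An edge orthogonal to `(p, q)` has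
horizontal length divisible by `q`, so the weight is at least `p q`. -/
theorem add_lt_newtonOrder [IsAlgClosed k] {α : Fin 2 → ℕ} (hα : ∀ c, 0 < α c)
    {g : MvPowerSeries (Fin 2) k} (hE : HasEdge α g)
    (hN : ∀ β : Fin 2 → ℕ, (∀ c, 0 < β c) → Nondegenerate β g)
    (hlin : ∀ c, coeff (single c 1) g = 0) (hg : Irreducible g) :
    α 0 + α 1 < newtonOrder α g := by
  obtain ⟨r, p, q, hr, hpq, h0, h1⟩ : ∃ r p q, 0 < r ∧ Nat.Coprime p q ∧ α 0 = r * p ∧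
      α 1 = r * q := by
    obtain ⟨p, q, hpq, h0, h1⟩ := Nat.exists_coprime (α 0) (α 1)
    exact ⟨(α 0).gcd (α 1), p, q, Nat.gcd_pos_of_pos_left _ (hα 0), hpq, by rw [mul_comm]; exact h0,
      by rw [mul_comm]; exact h1⟩
  set β : Fin 2 → ℕ := ![p, q] with hβ
  have hβ0 : β 0 = p := rfl
  have hβ1 : β 1 = q := rfl
  have hβpos : ∀ c, 0 < β c := by
    refine Fin.forall_fin_two.2 ⟨?_, ?_⟩
    · have := hα 0
      rw [h0] at this
      exact Nat.pos_of_mul_pos_left this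
    · have := hα 1
      rw [h1] at this
      exact Nat.pos_of_mul_pos_left this
  have hw : ∀ d : Fin 2 →₀ ℕ, weight α d = r * weight β d := by
    intro d
    rw [weight_fin_two, weight_fin_two, h0, h1, hβ0, hβ1]
    ring
  have hν : newtonOrder α g = r * newtonOrder β g := by
    obtain ⟨d, hd, hwd⟩ := exists_weight_eq_newtonOrder α hE.ne_zero
    obtain ⟨e, he, hwe⟩ := exists_weight_eq_newtonOrder β hE.ne_zero
    apply le_antisymm
    · rw [← hwe, ← hw]
      exact newtonOrder_le_weight α he
    · rw [← hwd, hw]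
      exact Nat.mul_le_mul_left r (newtonOrder_le_weight β hd)
  have hEβ : HasEdge β g := by
    obtain ⟨d, e, hd, he, hne, hwd, hwe⟩ := hE
    rw [hw, hν] at hwd hwe
    exact ⟨d, e, hd, he, hne, Nat.eq_of_mul_eq_mul_left hr hwd, Nat.eq_of_mul_eq_mul_left hr hwe⟩
  have hp1 : p ≠ 1 := fun h =>
    not_irreducible_of_weight_eq_one hβpos hEβ (hN β hβpos) hlin (o := 0) h hg
  have hq1 : q ≠ 1 := fun h =>
    not_irreducible_of_weight_eq_one hβpos hEβ (hN β hβpos) hlin (o := 1) h hg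
  have hp0 : 0 < p := hβpos 0
  have hq0 : 0 < q := hβpos 1
  obtain ⟨d, e, -, -, hwd, hwe, h3, h4⟩ := hEβ.exists_lt hβpos
  rw [weight_fin_two, hβ0, hβ1] at hwd hwe
  have hdiv : q ∣ d 0 - e 0 := by
    refine hpq.symm.dvd_of_dvd_mul_left ⟨e 1 - d 1, ?_⟩
    zify [h3.le, h4.le]
    have : (p : ℤ) * d 0 + q * d 1 = p * e 0 + q * e 1 := by exact_mod_cast hwd.trans hwe.symm
    linarith
  have hqd : q ≤ d 0 := (Nat.le_of_dvd (by omega) hdiv).trans (Nat.sub_le _ _)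
  have hne : p ≠ q := by
    rintro rfl
    rw [Nat.coprime_self] at hpq
    exact hp1 hpq
  have hpq' : p + q < p * q := by
    obtain ⟨p', rfl⟩ : ∃ p', p = p' + 2 := ⟨p - 2, by omega⟩
    obtain ⟨q', rfl⟩ : ∃ q', q = q' + 2 := ⟨q - 2, by omega⟩
    have : 0 < p' + q' := by omega
    nlinarith [Nat.zero_le (p' * q')]
  rw [hν, h0, h1, ← mul_add]
  refine Nat.mul_lt_mul_of_pos_left (hpq'.trans_le ?_) hr
  calc p * q ≤ p * d 0 := Nat.mul_le_mul_left _ hqd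
    _ ≤ _ := by omega

end Order

end

end NewtonJets

namespace NewtonJets

open MvPowerSeries Finsupp

noncomputable section

/-! ### Strata of jets in terms of `jetCoeff`, and equations on their closures. -/

section Jets

variable {R : Type*} [CommRing R] {m : ℕ}

/-- The series `w_c` with `x_c = t ^ α_c w_c`, for the jet `(x_0, x_1)` with coordinates `z`. -/
def jetTail (α : Fin 2 → ℕ) (z : Fin 2 × Fin (m + 1) → R) (c : Fin 2) : PowerSeries R :=
  PowerSeries.mk fun i => if h : i + α c < m + 1 then z (c, ⟨i + α c, h⟩) else 0

theorem map_jetTail {R' : Type*} [CommRing R'] (φ : R →+* R') (α : Fin 2 → ℕ)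
    (z : Fin 2 × Fin (m + 1) → R) (c : Fin 2) :
    PowerSeries.map φ (jetTail α z c) = jetTail α (fun p => φ (z p)) c := by
  ext i
  simp only [jetTail, PowerSeries.coeff_map, PowerSeries.coeff_mk]
  split_ifs <;> simp

theorem coeff_jetTail (α : Fin 2 → ℕ) (z : Fin 2 × Fin (m + 1) → R) (c : Fin 2) (i : ℕ)
    (h : i + α c < m + 1) : PowerSeries.coeff i (jetTail α z c) = z (c, ⟨i + α c, h⟩) := by
  rw [jetTail, PowerSeries.coeff_mk, dif_pos h]

variable {k : Type*} [Field k]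

theorem jetSeries_eq {α : Fin 2 → ℕ} {z : JetPlane k m}
    (hz : ∀ c, ∀ i < α c, PowerSeries.coeff i (jetSeries z c) = 0) (c : Fin 2) :
    jetSeries z c = PowerSeries.X ^ α c * jetTail α z c := by
  ext i
  rw [PowerSeries.coeff_X_pow_mul']
  split_ifs with h
  · obtain ⟨j, rfl⟩ := Nat.exists_eq_add_of_le' h
    simp [jetSeries, jetTail]
  · exact hz c i (by omega)

theorem coeff_pullback {α : Fin 2 → ℕ} (hα : ∀ c, 0 < α c) (g : MvPowerSeries (Fin 2) k)
    {z : JetPlane k m} (hz : ∀ c, ∀ i < α c, PowerSeries.coeff i (jetSeries z c) = 0) (N : ℕ) :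
    PowerSeries.coeff N (pullback g z) = jetCoeff α g N (jetTail α z) := by
  rw [← coeff_subst_X_pow_mul hα, pullback]
  congr 2
  exact funext (jetSeries_eq hz)

theorem constantCoeff_jetTail (α : Fin 2 → ℕ) (z : JetPlane k m) (c : Fin 2) :
    PowerSeries.constantCoeff (jetTail α z c) = PowerSeries.coeff (α c) (jetSeries z c) := by
  rw [← PowerSeries.coeff_zero_eq_constantCoeff_apply]
  simp [jetSeries, jetTail]

theorem mem_jetStratum_iff {α : Fin 2 → ℕ} (hα : ∀ c, 0 < α c) (g : MvPowerSeries (Fin 2) k)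
    (n : ℕ) (z : JetPlane k m) : z ∈ jetStratum g α n m ↔
      (∀ c, ∀ i < α c, PowerSeries.coeff i (jetSeries z c) = 0) ∧
      (∀ c, PowerSeries.constantCoeff (jetTail α z c) ≠ 0) ∧
      ∀ j ≤ n, jetCoeff α g j (jetTail α z) = 0 := by
  rw [jetStratum, Set.mem_ofPred_eq]
  refine and_congr_right fun h => and_congr ?_ ?_
  · simp only [constantCoeff_jetTail]
  · simp only [coeff_pullback hα g h]

theorem coeff_jetSeries_eq_zero_of_mem_zariskiClosure {α : Fin 2 → ℕ}
    {g : MvPowerSeries (Fin 2) k} {n : ℕ} {z : JetPlane k m}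
    (hz : z ∈ zariskiClosure (jetStratum g α n m)) (c : Fin 2) (i : ℕ) (hi : i < α c) :
    PowerSeries.coeff i (jetSeries z c) = 0 := by
  rw [jetSeries, PowerSeries.coeff_mk]
  split_ifs with h
  · have := hz (MvPolynomial.X (c, ⟨i, h⟩)) fun y hy => by
      have := hy.1 c i hi
      rw [jetSeries, PowerSeries.coeff_mk, dif_pos h] at this
      rw [MvPolynomial.aeval_X, this]
    rwa [MvPolynomial.aeval_X] at this
  · rfl

/-- Exhibits the equations of a stratum as polynomials in the jet coordinates. They can thus be
carried to Zariski closures and to generic points. -/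
theorem aeval_jetCoeff_X {A : Type*} [CommRing A] [Algebra k A] (α : Fin 2 → ℕ)
    (g : MvPowerSeries (Fin 2) k) (N : ℕ) (z : Fin 2 × Fin (m + 1) → A) :
    MvPolynomial.aeval z (jetCoeff α g N (jetTail α
      (MvPolynomial.X : Fin 2 × Fin (m + 1) → MvPolynomial (Fin 2 × Fin (m + 1)) k))) =
      jetCoeff α g N (jetTail α z) := by
  rw [jetCoeff_map]
  congr 1
  funext c
  rw [map_jetTail]
  congr 1
  funext p
  simp

theorem coeff_pullback_eq_zero_of_mem_zariskiClosure {α : Fin 2 → ℕ} (hα : ∀ c, 0 < α c)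
    {g : MvPowerSeries (Fin 2) k} {n : ℕ} {z : JetPlane k m}
    (hz : z ∈ zariskiClosure (jetStratum g α n m)) (N : ℕ) (hN : N ≤ n) :
    PowerSeries.coeff N (pullback g z) = 0 := by
  rw [coeff_pullback hα g (coeff_jetSeries_eq_zero_of_mem_zariskiClosure hz), ← aeval_jetCoeff_X]
  refine hz _ fun y hy => ?_
  rw [aeval_jetCoeff_X]
  exact ((mem_jetStratum_iff hα g n y).1 hy).2.2 N hN

/-- The jet of the arc `x_c = t ^ α_c w_c`. -/
def jetOf (m : ℕ) (α : Fin 2 → ℕ) (w : Fin 2 → PowerSeries k) : JetPlane k m :=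
  fun p => if α p.1 ≤ p.2 then PowerSeries.coeff (p.2 - α p.1) (w p.1) else 0

theorem coeff_jetTail_jetOf (α : Fin 2 → ℕ) (w : Fin 2 → PowerSeries k) (c : Fin 2) (i : ℕ)
    (h : i + α c ≤ m) :
    PowerSeries.coeff i (jetTail α (jetOf m α w) c) = PowerSeries.coeff i (w c) := by
  rw [coeff_jetTail α _ c i (by omega), jetOf, if_pos (by simp)]
  simp

theorem coeff_jetSeries_jetOf (α : Fin 2 → ℕ) (w : Fin 2 → PowerSeries k) (c : Fin 2) (i : ℕ)
    (hi : i < α c) : PowerSeries.coeff i (jetSeries (jetOf m α w) c) = 0 := by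
  rw [jetSeries, PowerSeries.coeff_mk]
  split_ifs with h
  · rw [jetOf, if_neg (by simpa using hi)]
  · rfl

theorem coeff_pullback_jetOf {α : Fin 2 → ℕ} (hα : ∀ c, 0 < α c) (g : MvPowerSeries (Fin 2) k)
    (w : Fin 2 → PowerSeries k) (n : ℕ) (hm : ∀ c, n + α c ≤ m) :
    PowerSeries.coeff (newtonOrder α g + n) (pullback g (jetOf m α w)) =
      jetCoeff α g (newtonOrder α g + n) w := by
  rw [coeff_pullback hα g (coeff_jetSeries_jetOf α w)]
  exact jetCoeff_congr hα g fun c j hj => coeff_jetTail_jetOf α w c j (by have := hm c; omega)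

theorem jetOf_mem_jetStratum {α : Fin 2 → ℕ} (hα : ∀ c, 0 < α c) {g : MvPowerSeries (Fin 2) k}
    {w : Fin 2 → PowerSeries k} (hw : ∀ c, PowerSeries.constantCoeff (w c) ≠ 0) {n : ℕ}
    (hm : ∀ c, n + α c ≤ m) (h : ∀ j ≤ n, jetCoeff α g (newtonOrder α g + j) w = 0) :
    jetOf m α w ∈ jetStratum g α (newtonOrder α g + n) m := by
  refine ⟨coeff_jetSeries_jetOf α w, fun c => ?_, fun N hN => ?_⟩
  · rw [← constantCoeff_jetTail, ← PowerSeries.coeff_zero_eq_constantCoeff_apply,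
      coeff_jetTail_jetOf α w c 0 (by have := hm c; omega),
      PowerSeries.coeff_zero_eq_constantCoeff_apply]
    exact hw c
  · rcases Nat.lt_or_ge N (newtonOrder α g) with hlt | hge
    · rw [coeff_pullback hα g (coeff_jetSeries_jetOf α w)]
      exact jetCoeff_eq_zero_of_lt hα hlt _
    · obtain ⟨j, rfl⟩ := Nat.exists_eq_add_of_le hge
      rw [coeff_pullback_jetOf hα g w j fun c => by have := hm c; omega]
      exact h j (by omega)

end Jets

end

end NewtonJets

namespace NewtonJets

open MvPowerSeries Finsupp

noncomputable section

/-! ### Upper bound for the dimension of a stratum, by transcendence degree. -/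

section Dimension

variable {k : Type*} [Field k]

theorem jetCoeff_mem {A : Type*} [CommRing A] [Algebra k A] (T : Subalgebra k A) (α : Fin 2 → ℕ)
    (g : MvPowerSeries (Fin 2) k) (N : ℕ) {w : Fin 2 → PowerSeries A}
    (hw : ∀ c j, PowerSeries.coeff j (w c) ∈ T) : jetCoeff α g N w ∈ T := by
  let w' : Fin 2 → PowerSeries T := fun c => PowerSeries.mk fun j => ⟨_, hw c j⟩
  have h : (fun c => PowerSeries.map (T.val : T →+* A) (w' c)) = w := by
    funext c
    ext j
    simp [w']
  rw [← h, ← jetCoeff_map]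
  exact (jetCoeff α g N w').2

theorem aeval_mem_subalgebra {σ A : Type*} [CommRing A] [Algebra k A] (T : Subalgebra k A)
    {a : σ → A} (ha : ∀ i, a i ∈ T) (F : MvPolynomial σ k) : MvPolynomial.aeval a F ∈ T := by
  induction F using MvPolynomial.induction_on with
  | C r =>
    rw [MvPolynomial.aeval_C]
    exact T.algebraMap_mem r
  | add p q hp hq =>
    rw [map_add]
    exact T.add_mem hp hq
  | mul_X p i hp =>
    rw [map_mul, MvPolynomial.aeval_X]
    exact T.mul_mem hp (ha i)

theorem derivative_aeval_update {σ B : Type*} [DecidableEq σ] [CommRing B] [Algebra k B] (c : σ)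
    (a : σ → B) (F : MvPolynomial σ k) :
    Polynomial.derivative (MvPolynomial.aeval
      (fun i => if i = c then (Polynomial.X : Polynomial B) else Polynomial.C (a i)) F) =
      MvPolynomial.aeval
        (fun i => if i = c then (Polynomial.X : Polynomial B) else Polynomial.C (a i))
        (MvPolynomial.pderiv c F) := by
  induction F using MvPolynomial.induction_on with
  | C r =>
    simp [Polynomial.algebraMap_apply]
  | add p q hp hq => simp only [map_add, hp, hq]
  | mul_X p i hp =>
    rw [map_mul, MvPolynomial.aeval_X, Polynomial.derivative_mul, hp, MvPolynomial.pderiv_mul,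
      map_add, map_mul, map_mul, MvPolynomial.aeval_X, MvPolynomial.pderiv_X, Pi.single_apply]
    by_cases hi : i = c <;> simp [hi, eq_comm]

/-- The indices of the coordinates that parametrize the jets of order `m`: all those of `x_o`, and
those of `x_c` that do not enter into the equations. -/
def freeIndex (m : ℕ) (α : Fin 2 → ℕ) (ν : ℕ) (c o : Fin 2) :
    Fin (m + 1 - α o) ⊕ Fin (ν - α c) → Fin 2 × Fin (m + 1) :=
  Sum.elim (fun i => (o, Fin.ofNat (m + 1) (i + α o)))
    fun i => (c, Fin.ofNat (m + 1) (m - ν + 1 + i + α c))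

variable {m : ℕ} {α : Fin 2 → ℕ} {g : MvPowerSeries (Fin 2) k} {c o : Fin 2}

/-- Hensel's recursion read over the field of a generic point: the constant term of `w_c` is a root
of a nonzero polynomial, and each later coefficient up to index `m - ν` solves a linear equation
with factor the derivative in `hD`. -/
theorem isAlgebraic_of_jetCoeff_eq_zero {K : Type*} [Field K] [Algebra k K] (hα : ∀ c, 0 < α c)
    (hoc : o ≠ c) (hle : ∀ c, α c ≤ newtonOrder α g) (hm : newtonOrder α g ≤ m)
    {x : Fin 2 × Fin (m + 1) → K} (hx0 : ∀ p : Fin 2 × Fin (m + 1), p.2 < α p.1 → x p = 0)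
    (hx : ∀ N ≤ m, jetCoeff α g N (jetTail α x) = 0)
    (hD : MvPolynomial.aeval (fun i => PowerSeries.constantCoeff (jetTail α x i))
      (MvPolynomial.pderiv c (initialForm α g)) ≠ 0) (p : Fin 2 × Fin (m + 1)) :
    IsAlgebraic (Algebra.adjoin k (Set.range (x ∘ freeIndex m α (newtonOrder α g) c o))) (x p) := by
  set ν := newtonOrder α g with hν
  set B := Algebra.adjoin k (Set.range (x ∘ freeIndex m α ν c o)) with hB
  have hother : ∀ i, i ≠ c → i = o := by
    intro i hi
    fin_cases i <;> fin_cases c <;> fin_cases o <;> simp_all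
  set T : Subalgebra k K := (Subalgebra.algebraicClosure B K).restrictScalars k with hT
  have hmemT : ∀ y, y ∈ T ↔ IsAlgebraic B y := fun y => Iff.rfl
  have hBT : ∀ y ∈ B, y ∈ T := fun y hy => isAlgebraic_algebraMap (⟨y, hy⟩ : B)
  have hinv : ∀ y ∈ T, y⁻¹ ∈ T := fun y hy => IsAlgebraic.inv_iff.2 hy
  have hco := hle o
  have hcc := hle c
  set W := jetTail α x with hW
  have hWo : ∀ j, PowerSeries.coeff j (W o) ∈ B := by
    intro j
    by_cases hj : j + α o < m + 1
    · rw [hW, coeff_jetTail α x o j hj]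
      refine Algebra.subset_adjoin ⟨Sum.inl ⟨j, by omega⟩, ?_⟩
      simp only [Function.comp_apply, freeIndex, Sum.elim_inl]
      congr 2
      ext
      simp [Nat.mod_eq_of_lt hj]
    · rw [hW, jetTail, PowerSeries.coeff_mk, dif_neg hj]
      exact B.zero_mem
  have hWc : ∀ j, PowerSeries.coeff j (W c) ∈ T := by
    intro n
    induction n using Nat.strong_induction_on with
    | _ n ih =>
    by_cases hn : n + α c < m + 1
    · by_cases hnν : m - ν < n
      · rw [hW, coeff_jetTail α x c n hn]
        refine hBT _ (Algebra.subset_adjoin ⟨Sum.inr ⟨n - (m - ν + 1), by omega⟩, ?_⟩)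
        simp only [Function.comp_apply, freeIndex, Sum.elim_inr]
        congr 2
        ext
        simp only [Fin.val_ofNat]
        rw [Nat.mod_eq_of_lt (by omega)]
        omega
      · rcases Nat.eq_zero_or_pos n with rfl | hn0
        · let U : B := ⟨_, hWo 0⟩
          let q : Fin 2 → Polynomial B := fun i => if i = c then Polynomial.X else Polynomial.C U
          have hq : (fun i => Polynomial.aeval (PowerSeries.coeff 0 (W c)) (q i)) =
              fun i => PowerSeries.constantCoeff (W i) := by
            funext i
            by_cases hi : i = c
            · simp [q, hi]
            · have hqi : q i = Polynomial.C U := if_neg hi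
              rw [hqi, Polynomial.aeval_C, hother i hi]
              change PowerSeries.coeff 0 (W o) = _
              rw [PowerSeries.coeff_zero_eq_constantCoeff_apply]
          have hq' : ∀ F : MvPolynomial (Fin 2) k,
              Polynomial.aeval (PowerSeries.coeff 0 (W c)) (MvPolynomial.aeval q F) =
                MvPolynomial.aeval (fun i => PowerSeries.constantCoeff (W i)) F := by
            intro F
            rw [← hq]
            induction F using MvPolynomial.induction_on with
            | C r =>
              rw [MvPolynomial.aeval_C, MvPolynomial.aeval_C, Polynomial.algebraMap_apply,
                Polynomial.aeval_C, ← IsScalarTower.algebraMap_apply]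
            | add p q hp hq => simp only [map_add, hp, hq]
            | mul_X p i hp => simp only [map_mul, MvPolynomial.aeval_X, hp]
          -- The initial form as a polynomial in `x_c` alone is nonzero, because its derivative does
          -- not vanish at the point.
          refine ⟨MvPolynomial.aeval q (initialForm α g), fun h0 => hD ?_, ?_⟩
          · rw [← hq', ← derivative_aeval_update, h0, Polynomial.derivative_zero, map_zero]
          · rw [hq', ← jetCoeff_newtonOrder hα]
            exact hx _ hm
        -- Truncate `W c` below `n`. The coefficient of order `ν + n` vanishes for `W`, so
        -- `jetCoeff_sub` expresses the `n`-th coefficient through data already known to be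
        -- algebraic.
        · let w : Fin 2 → PowerSeries K := fun i => if i = c then
            PowerSeries.mk (fun j => if j < n then PowerSeries.coeff j (W c) else 0) else W i
          have hwc : ∀ j, PowerSeries.coeff j (w c) =
              if j < n then PowerSeries.coeff j (W c) else 0 := fun j => by
            simp [w]
          have hwT : ∀ i j, PowerSeries.coeff j (w i) ∈ T := by
            intro i j
            by_cases hi : i = c
            · rw [hi, hwc]
              split_ifs with hj
              · exact ih j hj
              · exact T.zero_mem
            · simp only [w, if_neg hi]
              rw [hother i hi]
              exact hBT _ (hWo j)
          have hsub := jetCoeff_sub hα g (w := W) (w' := w) hn0 fun i j hj => by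
            by_cases hi : i = c
            · rw [hi, hwc, if_pos hj]
            · simp only [w, hi, if_false]
          rw [hx _ (by omega), Finset.sum_eq_single c, hwc, if_neg (lt_irrefl n), zero_sub,
            sub_zero] at hsub
          · have hmem := T.neg_mem (jetCoeff_mem T α g (ν + n) hwT)
            rw [hν, hsub] at hmem
            have hDT : MvPolynomial.aeval (fun i => PowerSeries.constantCoeff (W i))
                (MvPolynomial.pderiv c (initialForm α g)) ∈ T := by
              refine aeval_mem_subalgebra T (fun i => ?_) _
              rw [← PowerSeries.coeff_zero_eq_constantCoeff_apply]
              by_cases hi : i = c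
              · rw [hi]
                exact ih 0 hn0
              · rw [hother i hi]
                exact hBT _ (hWo 0)
            have := T.mul_mem (hinv _ hDT) hmem
            rwa [inv_mul_cancel_left₀ hD] at this
          · intro i _ hi
            simp only [w, hi, if_false, sub_self, mul_zero]
          · simp
    · rw [hW, jetTail, PowerSeries.coeff_mk, dif_neg hn]
      exact T.zero_mem
  change x p ∈ T
  obtain ⟨i, j⟩ := p
  rcases Nat.lt_or_ge j (α i) with hlt | hge
  · rw [hx0 _ hlt]
    exact T.zero_mem
  · have h1 : x (i, j) = PowerSeries.coeff (j - α i) (W i) := by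
      rw [hW, coeff_jetTail α x i _ (by omega)]
      congr 2
      ext
      simp [hge]
    rw [h1]
    by_cases hi : i = c
    · rw [hi]
      exact hWc _
    · rw [hother i hi]
      exact hBT _ (hWo _)

theorem map_aeval_constantCoeff_jetTail {A A' : Type*} [CommRing A] [Algebra k A] [CommRing A']
    [Algebra k A'] (φ : A →ₐ[k] A') (X : Fin 2 × Fin (m + 1) → A) (F : MvPolynomial (Fin 2) k) :
    φ (MvPolynomial.aeval (fun i => PowerSeries.constantCoeff (jetTail α X i)) F) =
      MvPolynomial.aeval
        (fun i => PowerSeries.constantCoeff (jetTail α (fun p => φ (X p)) i)) F := by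
  rw [← AlgHom.comp_apply, MvPolynomial.comp_aeval]
  congr 2
  funext i
  simp only [← PowerSeries.coeff_zero_eq_constantCoeff_apply, jetTail, PowerSeries.coeff_mk]
  split_ifs <;> simp

/-- Too many coordinates are algebraically dependent on the smooth part of a stratum. -/
theorem exists_polynomial_of_card_lt (hα : ∀ c, 0 < α c) (hoc : o ≠ c)
    (hle : ∀ c, α c ≤ newtonOrder α g) (hm : newtonOrder α g ≤ m) {ι : Type} [Fintype ι]
    (e : ι → Fin 2 × Fin (m + 1))
    (hcard : (m + 1 - α o) + (newtonOrder α g - α c) < Fintype.card ι) :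
    ∃ Q : MvPolynomial ι k, Q ≠ 0 ∧ ∀ z ∈ jetStratum g α m m,
      MvPolynomial.eval (fun i => PowerSeries.constantCoeff (jetTail α z i))
        (MvPolynomial.pderiv c (initialForm α g)) ≠ 0 → MvPolynomial.aeval (z ∘ e) Q = 0 := by
  by_contra! hcon
  let A := MvPolynomial (Fin 2 × Fin (m + 1)) k
  set S : Set (JetPlane k m) := {z ∈ jetStratum g α m m |
      MvPolynomial.eval (fun i => PowerSeries.constantCoeff (jetTail α z i))
        (MvPolynomial.pderiv c (initialForm α g)) ≠ 0} with hS
  set J : Ideal A := MvPolynomial.vanishingIdeal k S with hJ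
  set X : Fin 2 × Fin (m + 1) → A := MvPolynomial.X with hX
  set D : A := MvPolynomial.aeval (fun i => PowerSeries.constantCoeff (jetTail α X i))
    (MvPolynomial.pderiv c (initialForm α g)) with hD
  -- A prime over `J` avoiding `M` yields a generic point at which `D ≠ 0` and the coordinates
  -- picked by `e` are algebraically independent. They would outnumber the free coordinates, over
  -- which everything is algebraic.
  let M : Submonoid A := (nonZeroDivisors (MvPolynomial ι k)).map
    (MvPolynomial.rename e : MvPolynomial ι k →ₐ[k] A) ⊔ Submonoid.powers D
  have hdisj : Disjoint (J : Set A) M := by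
    rw [Set.disjoint_left]
    intro y hyJ hyM
    obtain ⟨_, ⟨Q, hQ, rfl⟩, _, ⟨n, rfl⟩, rfl⟩ := Submonoid.mem_sup.1 hyM
    obtain ⟨z, hz, hzD, hzQ⟩ := hcon Q (nonZeroDivisors.ne_zero hQ)
    have h := hyJ z ⟨hz, hzD⟩
    have hzX : (fun p => MvPolynomial.aeval z (X p)) = z :=
      funext fun p => MvPolynomial.aeval_X z p
    rw [map_mul, map_pow, map_aeval_constantCoeff_jetTail, hzX, aeval_self_apply] at h
    refine mul_ne_zero ?_ (pow_ne_zero n hzD) h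
    change MvPolynomial.aeval z (MvPolynomial.rename e Q) ≠ 0
    rw [MvPolynomial.aeval_rename]
    exact hzQ
  obtain ⟨P, hP, hJP, hPM⟩ := Ideal.exists_le_prime_disjoint _ _ hdisj
  rw [Set.disjoint_left] at hPM
  let K := FractionRing (A ⧸ P)
  let φ : A →ₐ[k] K := (Algebra.ofId (A ⧸ P) K).restrictScalars k |>.comp (Ideal.Quotient.mkₐ k P)
  have hφ : ∀ y, φ y = 0 ↔ y ∈ P := by
    intro y
    change algebraMap (A ⧸ P) K (Ideal.Quotient.mk P y) = 0 ↔ _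
    rw [FaithfulSMul.algebraMap_eq_zero_iff, Ideal.Quotient.eq_zero_iff_mem]
  set x : Fin 2 × Fin (m + 1) → K := fun p => φ (X p) with hx
  have hφx : φ = MvPolynomial.aeval x := MvPolynomial.aeval_unique φ
  have hindep : AlgebraicIndependent k (x ∘ e) := by
    rw [algebraicIndependent_iff]
    intro Q hQ
    by_contra hQ0
    refine hPM (a := MvPolynomial.rename e Q) ?_ (Submonoid.mem_sup_left
      ⟨Q, mem_nonZeroDivisors_of_ne_zero hQ0, rfl⟩)
    change MvPolynomial.rename e Q ∈ P
    rw [← hφ, hφx, MvPolynomial.aeval_rename]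
    exact hQ
  have hx0 : ∀ p : Fin 2 × Fin (m + 1), p.2 < α p.1 → x p = 0 := by
    intro p hp
    rw [hx, hφ]
    refine hJP fun z hz => ?_
    have := hz.1.1 p.1 p.2 hp
    rw [jetSeries, PowerSeries.coeff_mk, dif_pos p.2.2] at this
    rw [hX, MvPolynomial.aeval_X]
    exact this
  have hxN : ∀ N ≤ m, jetCoeff α g N (jetTail α x) = 0 := by
    intro N hN
    rw [← aeval_jetCoeff_X, ← hφx, hφ]
    refine hJP fun z hz => ?_
    rw [aeval_jetCoeff_X]
    exact ((mem_jetStratum_iff hα g m z).1 hz.1).2.2 N hN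
  have hxD : MvPolynomial.aeval (fun i => PowerSeries.constantCoeff (jetTail α x i))
      (MvPolynomial.pderiv c (initialForm α g)) ≠ 0 := by
    rw [hx, ← map_aeval_constantCoeff_jetTail, ← hD, Ne, hφ]
    exact fun h => hPM h (Submonoid.mem_sup_right ⟨1, pow_one D⟩)
  have halg : Algebra.IsAlgebraic
      (Algebra.adjoin k (Set.range (x ∘ freeIndex m α (newtonOrder α g) c o))) K := by
    set B := Algebra.adjoin k (Set.range (x ∘ freeIndex m α (newtonOrder α g) c o))
    have hφalg : ∀ y, φ y ∈ (Subalgebra.algebraicClosure B K).restrictScalars k := by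
      intro y
      rw [hφx]
      exact aeval_mem_subalgebra _
        (isAlgebraic_of_jetCoeff_eq_zero hα hoc hle hm hx0 hxN hxD) y
    have hφalg' : ∀ y, IsAlgebraic B (φ y) := hφalg
    refine ⟨fun y => ?_⟩
    obtain ⟨a, b, hb, rfl⟩ := IsFractionRing.div_surjective (A := A ⧸ P) y
    obtain ⟨a, rfl⟩ := Ideal.Quotient.mk_surjective a
    obtain ⟨b, rfl⟩ := Ideal.Quotient.mk_surjective b
    rw [div_eq_mul_inv]
    exact (hφalg' a).mul (IsAlgebraic.inv_iff.2 (hφalg' b))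
  have h1 := hindep.lift_cardinalMk_le_trdeg
  have h2 := Algebra.IsAlgebraic.trdeg_le_cardinalMk k
    (Set.range (x ∘ freeIndex m α (newtonOrder α g) c o))
  have h3 := Cardinal.mk_range_le_lift (f := x ∘ freeIndex m α (newtonOrder α g) c o)
  have h4 := Cardinal.lift_le.1 ((h1.trans (Cardinal.lift_le.2 h2)).trans h3)
  rw [Cardinal.mk_fintype, Cardinal.mk_fintype, Nat.cast_le, Fintype.card_sum, Fintype.card_fin,
    Fintype.card_fin] at h4
  omega

end Dimension

end

end NewtonJets

namespace NewtonJets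

open MvPowerSeries Finsupp

noncomputable section

/-! ### Smooth points, free coordinates and factors. -/

section Strata

variable {k : Type*} [Field k] {m : ℕ} {α : Fin 2 → ℕ} {g : MvPowerSeries (Fin 2) k}

theorem sum_fin_two_of_ne {c o : Fin 2} (hoc : o ≠ c) (α : Fin 2 → ℕ) :
    α o + α c = α 0 + α 1 := by
  fin_cases c <;> fin_cases o <;> simp_all [add_comm]

/-- Nondegeneracy covers the stratum by the two open sets where one of the partial derivatives is
nonzero; the product of the two relations holds on both. -/
theorem exists_polynomial_of_nondegenerate (hα : ∀ c, 0 < α c)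
    (hle : ∀ c, α c ≤ newtonOrder α g) (hm : newtonOrder α g ≤ m)
    (hN : Nondegenerate α g) {ι : Type} [Fintype ι] (e : ι → Fin 2 × Fin (m + 1))
    (hcard : m + 1 + newtonOrder α g < Fintype.card ι + (α 0 + α 1)) :
    ∃ Q : MvPolynomial ι k, Q ≠ 0 ∧ ∀ z ∈ jetStratum g α m m, MvPolynomial.aeval (z ∘ e) Q = 0 := by
  have h0 := hle 0
  have h1 := hle 1
  obtain ⟨Q₀, hQ₀, hz₀⟩ := exists_polynomial_of_card_lt (c := 0) (o := 1) hα (by simp) hle hm e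
    (by omega)
  obtain ⟨Q₁, hQ₁, hz₁⟩ := exists_polynomial_of_card_lt (c := 1) (o := 0) hα (by simp) hle hm e
    (by omega)
  refine ⟨Q₀ * Q₁, mul_ne_zero hQ₀ hQ₁, fun z hz => ?_⟩
  obtain ⟨-, hz1, hz2⟩ := (mem_jetStratum_iff hα g m z).1 hz
  have hroot := hz2 _ hm
  rw [jetCoeff_newtonOrder hα, aeval_self_apply] at hroot
  obtain ⟨c, hc⟩ := hN _ hz1 hroot
  rw [map_mul]
  revert c
  refine Fin.forall_fin_two.2 ⟨fun hc => ?_, fun hc => ?_⟩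
  · rw [hz₀ z hz hc, zero_mul]
  · rw [hz₁ z hz hc, mul_zero]

theorem exists_arc (hα : ∀ c, 0 < α c) {a : Fin 2 → k}
    (ha : MvPolynomial.eval a (initialForm α g) = 0) {c : Fin 2}
    (hc : MvPolynomial.eval a (MvPolynomial.pderiv c (initialForm α g)) ≠ 0) (τ : ℕ → k) (K : ℕ) :
    ∃ w : Fin 2 → PowerSeries k, (∀ i, PowerSeries.constantCoeff (w i) = a i) ∧
      jetCoeff α g (newtonOrder α g) w = 0 ∧
      ∀ n, 0 < n → n ≤ K → jetCoeff α g (newtonOrder α g + n) w = τ n := by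
  have hconst : (fun i => PowerSeries.constantCoeff (PowerSeries.C (a i))) = a := by
    funext i
    simp
  obtain ⟨w, h1, h2, h3⟩ := exists_lift hα g c (fun i => PowerSeries.C (a i))
    (by rw [hconst]; exact hc) τ K
  have hw : ∀ i, PowerSeries.constantCoeff (w i) = a i := by
    intro i
    by_cases hi : i = c
    · rw [hi, ← PowerSeries.coeff_zero_eq_constantCoeff_apply, h2 0 (Or.inl rfl)]
      simp
    · rw [h1 i hi]
      simp
  refine ⟨w, hw, ?_, h3⟩
  rw [jetCoeff_newtonOrder hα, aeval_self_apply, ← ha]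
  congr 2
  exact funext hw

theorem jetOf_ofNat (w : Fin 2 → PowerSeries k) (i : Fin 2) (n : ℕ) (h : n + α i ≤ m) :
    jetOf m α w (i, Fin.ofNat (m + 1) (n + α i)) = PowerSeries.coeff n (w i) := by
  have hv : (n + α i) % (m + 1) = n + α i := Nat.mod_eq_of_lt (by omega)
  simp [jetOf, hv]

/-- The free coordinates take arbitrary values on the stratum, as long as the first one is not
zero. -/
theorem exists_mem_jetStratum_aeval_ne_zero [IsAlgClosed k] (hα : ∀ c, 0 < α c) {c o : Fin 2}
    (hoc : o ≠ c) (hle : ∀ c, α c ≤ newtonOrder α g) (hm : newtonOrder α g ≤ m) {a : Fin 2 → k}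
    (ha0 : ∀ i, a i ≠ 0) (ha : MvPolynomial.eval a (initialForm α g) = 0)
    (hc : MvPolynomial.eval a (MvPolynomial.pderiv c (initialForm α g)) ≠ 0)
    {Q : MvPolynomial (Fin (m + 1 - α o) ⊕ Fin (newtonOrder α g - α c)) k} (hQ : Q ≠ 0) :
    ∃ z ∈ jetStratum g α m m,
      MvPolynomial.aeval (z ∘ freeIndex m α (newtonOrder α g) c o) Q ≠ 0 := by
  have hother : ∀ i, i ≠ c → i = o := by
    intro i hi
    fin_cases i <;> fin_cases c <;> fin_cases o <;> simp_all
  have hco := hle o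
  have hcc := hle c
  let i₀ : Fin (m + 1 - α o) := ⟨0, by omega⟩
  -- The extra factor makes the leading coefficient of `x_o` nonzero. An `α_o`-th root `s` then
  -- moves the torus zero `a` to one having this coordinate.
  obtain ⟨v, hv⟩ : ∃ v, MvPolynomial.eval v (Q * MvPolynomial.X (Sum.inl i₀)) ≠ 0 := by
    by_contra! h
    exact mul_ne_zero hQ (MvPolynomial.X_ne_zero _)
      (MvPolynomial.funext fun v => by rw [h v, map_zero])
  rw [map_mul, MvPolynomial.eval_X] at hv
  have hvQ := left_ne_zero_of_mul hv
  have hv0 := right_ne_zero_of_mul hv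
  obtain ⟨s, hs⟩ := IsAlgClosed.exists_pow_nat_eq (v (Sum.inl i₀) / a o) (hα o)
  have hs0 : s ≠ 0 := by
    rintro rfl
    rw [zero_pow (hα o).ne'] at hs
    exact div_ne_zero hv0 (ha0 o) hs.symm
  set b : Fin 2 → k := fun i => s ^ α i * a i with hb
  have hbo : b o = v (Sum.inl i₀) := by
    rw [hb]
    simp only
    rw [hs, div_mul_cancel₀ _ (ha0 o)]
  have hbne : ∀ i, b i ≠ 0 := fun i => mul_ne_zero (pow_ne_zero _ hs0) (ha0 i)
  have hb0 : MvPolynomial.eval b (initialForm α g) = 0 := by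
    rw [hb, eval_weighted_smul (isWeightedHomogeneous_initialForm hα g), ha, mul_zero]
  have hbc : MvPolynomial.eval b (MvPolynomial.pderiv c (initialForm α g)) ≠ 0 := by
    rw [hb, eval_weighted_smul ((isWeightedHomogeneous_initialForm hα g).pderiv
      (n' := newtonOrder α g - α c) (i := c) (by omega))]
    exact mul_ne_zero (pow_ne_zero _ hs0) hc
  -- For `0 < j ≤ m - ν` the truncated subtraction yields irrelevant values of `w c`: exactly these
  -- coefficients are replaced by the lifting.
  let w : Fin 2 → PowerSeries k := fun i => if i = c then
    PowerSeries.mk fun j => if j = 0 then b c else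
      if h : j - (m - newtonOrder α g + 1) < newtonOrder α g - α c then v (Sum.inr ⟨_, h⟩) else 0
    else PowerSeries.mk fun j => if h : j < m + 1 - α o then v (Sum.inl ⟨j, h⟩) else 0
  have hwc : w c = PowerSeries.mk fun j => if j = 0 then b c else
      if h : j - (m - newtonOrder α g + 1) < newtonOrder α g - α c then v (Sum.inr ⟨_, h⟩) else 0 := if_pos rfl
  have hwo : w o = PowerSeries.mk fun j =>
      if h : j < m + 1 - α o then v (Sum.inl ⟨j, h⟩) else 0 := if_neg hoc
  have hconst : (fun i => PowerSeries.constantCoeff (w i)) = b := by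
    funext i
    rw [← PowerSeries.coeff_zero_eq_constantCoeff_apply]
    by_cases hi : i = c
    · rw [hi, hwc, PowerSeries.coeff_mk, if_pos rfl]
    · rw [hother i hi, hwo, PowerSeries.coeff_mk, dif_pos (by omega), hbo]
  obtain ⟨w', h1, h2, h3⟩ := exists_lift hα g c w (by rw [hconst]; exact hbc) (fun _ => 0) (m - newtonOrder α g)
  have hw' : ∀ i, PowerSeries.constantCoeff (w' i) = b i := by
    intro i
    rw [← congrFun hconst i]
    by_cases hi : i = c
    · rw [hi, ← PowerSeries.coeff_zero_eq_constantCoeff_apply, h2 0 (Or.inl rfl),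
        PowerSeries.coeff_zero_eq_constantCoeff_apply]
    · rw [h1 i hi]
  refine ⟨jetOf m α w', ?_, ?_⟩
  · have hmem := jetOf_mem_jetStratum (m := m) (g := g) (w := w') (n := m - newtonOrder α g) hα
      (fun i => by rw [hw' i]; exact hbne i) (fun i => by have := hle i; omega) fun j hj => by
        rcases Nat.eq_zero_or_pos j with rfl | hj0
        · rw [add_zero, jetCoeff_newtonOrder hα, aeval_self_apply, ← hb0]
          congr 2
          exact funext hw'
        · exact h3 j hj0 hj
    rwa [Nat.add_sub_cancel' hm] at hmem
  · have hz : jetOf m α w' ∘ freeIndex m α (newtonOrder α g) c o = v := by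
      funext p
      rcases p with i | i
      · have hi := i.2
        simp only [Function.comp_apply, freeIndex, Sum.elim_inl]
        rw [jetOf_ofNat w' o i (by omega), h1 o hoc, hwo, PowerSeries.coeff_mk,
          dif_pos (by omega)]
      · have hi := i.2
        simp only [Function.comp_apply, freeIndex, Sum.elim_inr]
        rw [jetOf_ofNat w' c _ (by omega), h2 _ (by omega), hwc, PowerSeries.coeff_mk,
          if_neg (by omega), dif_pos (by omega)]
        congr
        omega
    rw [hz, aeval_self_apply]
    exact hvQ

theorem coeff_pullback_eq_zero_of_dvd {g h : MvPowerSeries (Fin 2) k} (hgh : g ∣ h)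
    {z : JetPlane k m} (hz : ∀ c, PowerSeries.coeff 0 (jetSeries z c) = 0) {n : ℕ}
    (hg : ∀ j ≤ n, PowerSeries.coeff j (pullback g z) = 0) (j : ℕ) (hj : j ≤ n) :
    PowerSeries.coeff j (pullback h z) = 0 := by
  obtain ⟨u, rfl⟩ := hgh
  have hs : MvPowerSeries.HasSubst (jetSeries z) := hasSubst_of_constantCoeff_zero fun c => by
    change PowerSeries.constantCoeff (jetSeries z c) = 0
    rw [← PowerSeries.coeff_zero_eq_constantCoeff_apply, hz c]
  rw [pullback, subst_mul hs]
  exact (coeff_mul_of_coeff_lt_eq_zero (δ := pullback g z) (n := n + 1)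
    (fun j hj => hg j (by omega)) _).1 j (by omega)

theorem jetStratum_subset_of_dvd {g h : MvPowerSeries (Fin 2) k} (hgh : g ∣ h)
    (hα : ∀ c, 0 < α c) (n : ℕ) : jetStratum g α n m ⊆ jetStratum h α n m :=
  fun _ hz => ⟨hz.1, hz.2.1,
    coeff_pullback_eq_zero_of_dvd hgh (fun c => hz.1 c 0 (hα c)) hz.2.2⟩

/-- Along the torus zeros of the initial form of a factor, nondegeneracy of a product says that the
factor is smooth and the cofactor does not vanish. -/
theorem Nondegenerate.of_mul {g h : MvPowerSeries (Fin 2) k} (hα : ∀ c, 0 < α c) (hg : g ≠ 0)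
    (hh : h ≠ 0) (hN : Nondegenerate α (g * h)) {a : Fin 2 → k} (ha : ∀ c, a c ≠ 0)
    (h0 : MvPolynomial.eval a (initialForm α g) = 0) :
    (∃ c, MvPolynomial.eval a (MvPolynomial.pderiv c (initialForm α g)) ≠ 0) ∧
      MvPolynomial.eval a (initialForm α h) ≠ 0 := by
  obtain ⟨c, hc⟩ := hN a ha (by rw [initialForm_mul hα hg hh, map_mul, h0, zero_mul])
  rw [initialForm_mul hα hg hh, MvPolynomial.pderiv_mul, map_add, map_mul, map_mul, h0, zero_mul,
    add_zero] at hc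
  exact ⟨⟨c, left_ne_zero_of_mul hc⟩, right_ne_zero_of_mul hc⟩

theorem newtonOrder_eq_of_associated {g h : MvPowerSeries (Fin 2) k} (hgh : Associated g h)
    (hg : g ≠ 0) (α : Fin 2 → ℕ) : newtonOrder α g = newtonOrder α h := by
  obtain ⟨u, rfl⟩ := hgh
  rw [newtonOrder_mul α hg u.ne_zero, newtonOrder_eq_zero_of_isUnit α u.isUnit, add_zero]

theorem IsSingularAtOrigin.coeff_single_eq_zero {f : MvPolynomial (Fin 2) k}
    (hf : IsSingularAtOrigin f) (c : Fin 2) :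
    coeff (single c 1) (f : MvPowerSeries (Fin 2) k) = 0 := by
  have := hf.2 c
  rw [MvPolynomial.eval_zero, MvPolynomial.constantCoeff_eq,
    MvPolynomial.coeff_pderiv] at this
  simpa using this

end Strata

end

end NewtonJets

namespace NewtonJets

open MvPowerSeries Finsupp

noncomputable section

/-! ### Comparison of two strata. -/

section Main

variable {k : Type*} [Field k] {m : ℕ} {α β : Fin 2 → ℕ}

theorem coeff_pullback_newtonOrder (hα : ∀ c, 0 < α c) (g : MvPowerSeries (Fin 2) k)
    {z : JetPlane k m} (hz : ∀ c, ∀ i < α c, PowerSeries.coeff i (jetSeries z c) = 0) :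
    PowerSeries.coeff (newtonOrder α g) (pullback g z) =
      MvPolynomial.eval (fun c => PowerSeries.constantCoeff (jetTail α z c)) (initialForm α g) := by
  rw [coeff_pullback hα g hz, jetCoeff_newtonOrder hα, aeval_self_apply]

theorem exists_mem_jetStratum {g : MvPowerSeries (Fin 2) k} (hα : ∀ c, 0 < α c) {a : Fin 2 → k}
    (ha : ∀ c, a c ≠ 0) (h0 : MvPolynomial.eval a (initialForm α g) = 0) {c : Fin 2}
    (hc : MvPolynomial.eval a (MvPolynomial.pderiv c (initialForm α g)) ≠ 0) {n : ℕ}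
    (hm : ∀ c, n + α c ≤ m) :
    ∃ z ∈ jetStratum g α (newtonOrder α g + n) m,
      (fun c => PowerSeries.constantCoeff (jetTail α z c)) = a := by
  obtain ⟨w, hw, hw0, hw1⟩ := exists_arc hα h0 hc (fun _ => 0) n
  refine ⟨jetOf m α w, jetOf_mem_jetStratum hα (fun c => by rw [hw c]; exact ha c) hm
    fun j hj => ?_, ?_⟩
  · rcases Nat.eq_zero_or_pos j with rfl | hj0
    · exact hw0
    · exact hw1 j hj0 hj
  · funext c
    rw [← hw c, ← PowerSeries.coeff_zero_eq_constantCoeff_apply,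
      ← PowerSeries.coeff_zero_eq_constantCoeff_apply,
      coeff_jetTail_jetOf α w c 0 (by have := hm c; omega)]

/-- The next equation does not follow from the earlier ones: the lifting can prescribe the value `1`
for it. -/
theorem exists_mem_jetStratum_coeff_ne_zero {g : MvPowerSeries (Fin 2) k} (hα : ∀ c, 0 < α c)
    {a : Fin 2 → k} (ha : ∀ c, a c ≠ 0) (h0 : MvPolynomial.eval a (initialForm α g) = 0)
    {c : Fin 2} (hc : MvPolynomial.eval a (MvPolynomial.pderiv c (initialForm α g)) ≠ 0) {n : ℕ}
    (hm : ∀ c, n + 1 + α c ≤ m) :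
    ∃ z ∈ jetStratum g α (newtonOrder α g + n) m,
      PowerSeries.coeff (newtonOrder α g + (n + 1)) (pullback g z) ≠ 0 := by
  obtain ⟨w, hw, hw0, hw1⟩ := exists_arc hα h0 hc (fun j => if j = n + 1 then 1 else 0) (n + 1)
  refine ⟨jetOf m α w, jetOf_mem_jetStratum hα (fun c => by rw [hw c]; exact ha c)
    (fun c => by have := hm c; omega) fun j hj => ?_, ?_⟩
  · rcases Nat.eq_zero_or_pos j with rfl | hj0
    · exact hw0
    · rw [hw1 j hj0 (by omega), if_neg (by omega)]
  · rw [coeff_pullback_jetOf hα g w _ hm, hw1 _ (by omega) le_rfl, if_pos rfl]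
    exact one_ne_zero

theorem le_of_mem_zariskiClosure {g h : MvPowerSeries (Fin 2) k} {p q : ℕ} {z : JetPlane k m}
    (hz : z ∈ jetStratum g α p m) (hz' : z ∈ zariskiClosure (jetStratum h β q m)) (c : Fin 2) :
    β c ≤ α c := by
  by_contra! hlt
  exact hz.2.1 c (coeff_jetSeries_eq_zero_of_mem_zariskiClosure hz' c _ hlt)

theorem Nondegenerate.left_of_mul {g h : MvPowerSeries (Fin 2) k} (hα : ∀ c, 0 < α c)
    (hg : g ≠ 0) (hh : h ≠ 0) (hN : Nondegenerate α (g * h)) : Nondegenerate α g :=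
  fun _ ha h0 => (hN.of_mul hα hg hh ha h0).1

/-- If the stratum of a factor `g` lies in the closure of the stratum of an irreducible factor `h`
of the same curve, then the factors agree. -/
theorem associated_of_subset_zariskiClosure [IsAlgClosed k] {g h u v : MvPowerSeries (Fin 2) k}
    (hg : Irreducible g) (hh : Irreducible h) (huv : g * u = h * v) (hu : u ≠ 0) (hv : v ≠ 0)
    (hα : ∀ c, 0 < α c) (hβ : ∀ c, 0 < β c) (hE : HasEdge α g) (hN : Nondegenerate α (g * u))
    {p q : ℕ} (hp : p + newtonOrder α u = m) (hq : q + newtonOrder β v = m)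
    (hmα : newtonOrder α (g * u) ≤ m)
    (hsub : jetStratum g α p m ⊆ zariskiClosure (jetStratum h β q m)) :
    (∀ c, β c ≤ α c) ∧ Associated g h := by
  obtain ⟨a, ha, h0⟩ := hE.exists_torus_root hα
  obtain ⟨⟨c, hc⟩, hau⟩ := hN.of_mul hα hE.ne_zero hu ha h0
  have hgu := newtonOrder_mul α hE.ne_zero hu
  obtain ⟨z, hz, hza⟩ := exists_mem_jetStratum (m := m) hα ha h0 hc
    (n := m - newtonOrder α (g * u)) fun c => by
      have := hE.le_newtonOrder hα c
      omega
  rw [show newtonOrder α g + (m - newtonOrder α (g * u)) = p by omega] at hz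
  have hle := le_of_mem_zariskiClosure hz (hsub hz)
  refine ⟨hle, ?_⟩
  rcases (prime_of_irreducible hh).dvd_or_dvd (huv ▸ dvd_mul_right h v) with hd | ⟨u', rfl⟩
  · exact (hh.associated_of_dvd hg hd).symm
  · exfalso
    have hhv := newtonOrder_mul α hh.ne_zero hv
    have hmono := newtonOrder_mono hle hv
    rw [← huv] at hhv
    -- The order is in range: `ν_α(h) = ν_α(h v) - ν_α(v) ≤ m - ν_β(v) = q`.
    have := coeff_pullback_eq_zero_of_mem_zariskiClosure hβ (hsub hz) (newtonOrder α h) (by omega)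
    rw [coeff_pullback_newtonOrder hα h hz.1, hza] at this
    rw [initialForm_mul hα hh.ne_zero (right_ne_zero_of_mul hu), map_mul, this, zero_mul] at hau
    exact hau rfl

/-- A stratum of equations of order `m` has codimension `m + 1 - ν + α 0 + α 1`, and the codimension
of a stratum is at least that of a stratum whose closure contains it. -/
theorem newtonOrder_add_le_of_subset_zariskiClosure [IsAlgClosed k] {g h : MvPowerSeries (Fin 2) k}
    (hα : ∀ c, 0 < α c) (hβ : ∀ c, 0 < β c) (hEα : HasEdge α g) (hEβ : HasEdge β h)
    (hNα : Nondegenerate α g) (hNβ : Nondegenerate β h) (hmα : newtonOrder α g ≤ m)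
    (hmβ : newtonOrder β h ≤ m)
    (hsub : jetStratum g α m m ⊆ zariskiClosure (jetStratum h β m m)) :
    newtonOrder α g + (β 0 + β 1) ≤ newtonOrder β h + (α 0 + α 1) := by
  by_contra! hlt
  obtain ⟨a, ha, h0⟩ := hEα.exists_torus_root hα
  obtain ⟨c, hc⟩ := hNα a ha h0
  obtain ⟨o, hoc⟩ : ∃ o, o ≠ c := ⟨c + 1, by fin_cases c <;> simp⟩
  have hs := sum_fin_two_of_ne hoc α
  have hco := hEα.le_newtonOrder hα o
  have hcc := hEα.le_newtonOrder hα c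
  -- The free coordinates of the smaller stratum would be too many for the larger one, so a relation
  -- `Q` holds on it and on its closure. On the smaller stratum they satisfy no relation.
  obtain ⟨Q, hQ, hvan⟩ := exists_polynomial_of_nondegenerate hβ (hEβ.le_newtonOrder hβ) hmβ hNβ
    (freeIndex m α (newtonOrder α g) c o) (by
      rw [Fintype.card_sum, Fintype.card_fin, Fintype.card_fin]
      omega)
  obtain ⟨z, hz, hzQ⟩ := exists_mem_jetStratum_aeval_ne_zero hα hoc (hEα.le_newtonOrder hα) hmα
    ha h0 hc hQ
  refine hzQ ?_
  rw [← MvPolynomial.aeval_rename]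
  refine hsub hz _ fun y hy => ?_
  rw [MvPolynomial.aeval_rename]
  exact hvan y hy

theorem eq_of_subset_zariskiClosure [IsAlgClosed k] {F g h u v : MvPowerSeries (Fin 2) k}
    (hg : Irreducible g) (hgh : Associated g h) (hFu : F = g * u) (hFv : F = h * v) (hF : F ≠ 0)
    (hα : ∀ c, 0 < α c) (hβ : ∀ c, 0 < β c) (hEα : HasEdge α g) (hEβ : HasEdge β g)
    (hN : ∀ γ : Fin 2 → ℕ, (∀ c, 0 < γ c) → Nondegenerate γ F)
    (hlin : ∀ c, coeff (single c 1) F = 0)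
    {p q : ℕ} (hp : p + newtonOrder α u = m) (hq : q + newtonOrder β v = m)
    (hmα : newtonOrder α F ≤ m) (hmβ : newtonOrder β F ≤ m) {s : ℝ} (hs : ∀ c, (α c : ℝ) = s * β c)
    (hle : ∀ c, β c ≤ α c)
    (hsub : jetStratum g α p m ⊆ zariskiClosure (jetStratum h β q m)) : α = β := by
  have hh0 : h ≠ 0 := hgh.ne_zero_iff.1 hg.ne_zero
  have hu : u ≠ 0 := by
    rintro rfl
    exact hF (by rw [hFu, mul_zero])
  have hv : v ≠ 0 := by
    rintro rfl
    exact hF (by rw [hFv, mul_zero])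
  have hβ0 : (0 : ℝ) < β 0 := Nat.cast_pos.2 (hβ 0)
  have hs1 : 1 ≤ s := by
    have h1 : (β 0 : ℝ) ≤ α 0 := Nat.cast_le.2 (hle 0)
    rw [hs 0] at h1
    exact le_of_mul_le_mul_right (by rwa [one_mul]) hβ0
  rcases hs1.eq_or_lt with rfl | hs1
  · funext c
    exact_mod_cast (hs c).trans (one_mul _)
  exfalso
  have hlt : ∀ c, β c < α c := fun c => by
    have hβc : (0 : ℝ) < β c := Nat.cast_pos.2 (hβ c)
    rw [← Nat.cast_lt (α := ℝ), hs c]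
    nlinarith
  have hNg : ∀ γ : Fin 2 → ℕ, (∀ c, 0 < γ c) → Nondegenerate γ g := fun γ hγ =>
    Nondegenerate.left_of_mul hγ hg.ne_zero hu (by rw [← hFu]; exact hN γ hγ)
  have hFα := newtonOrder_mul α hg.ne_zero hu
  have hFβ := newtonOrder_mul β hg.ne_zero hu
  have hFβ' := newtonOrder_mul β hh0 hv
  have hghβ := newtonOrder_eq_of_associated hgh hg.ne_zero β
  rw [← hFu] at hFα hFβ
  rw [← hFv] at hFβ'
  by_cases hunit : IsUnit u
  · have hu0 := newtonOrder_eq_zero_of_isUnit α hunit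
    have hu0' := newtonOrder_eq_zero_of_isUnit β hunit
    obtain rfl : p = m := by omega
    obtain rfl : q = p := by omega
    have hsub' : jetStratum g α q q ⊆ zariskiClosure (jetStratum g β q q) := by
      refine hsub.trans fun z hz P hP => hz P ?_
      exact fun y hy => hP y (jetStratum_subset_of_dvd hgh.symm.dvd hβ q hy)
    have hineq := newtonOrder_add_le_of_subset_zariskiClosure hα hβ hEα hEβ (hNg α hα) (hNg β hβ)
      (by omega) (by omega) hsub'
    have hlin' : ∀ c, coeff (single c 1) g = 0 := fun c => by
      have hc := hlin c
      have hg0 : constantCoeff g = 0 := by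
        by_contra hne
        exact hg.not_isUnit (MvPowerSeries.isUnit_iff_constantCoeff.2 (Ne.isUnit hne))
      rw [hFu, coeff_single_one_mul c u hg0] at hc
      exact (mul_eq_zero.1 hc).resolve_right
        (MvPowerSeries.isUnit_iff_constantCoeff.1 hunit).ne_zero
    have hbig := add_lt_newtonOrder hβ hEβ hNg hlin' hg
    obtain ⟨d, hd, hwd⟩ := exists_weight_eq_newtonOrder α hg.ne_zero
    have hd' := newtonOrder_le_weight β hd
    rw [weight_fin_two] at hwd hd'
    -- With `h2`, this gives `(s - 1) ν_β(g) ≤ (s - 1)(β_0 + β_1)`, against `h3`.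
    have h1 : s * ((newtonOrder β g : ℕ) : ℝ) ≤ ((newtonOrder α g : ℕ) : ℝ) := by
      rw [← hwd]
      push_cast
      rw [hs 0, hs 1]
      have : ((newtonOrder β g : ℕ) : ℝ) ≤ β 0 * d 0 + β 1 * d 1 := by exact_mod_cast hd'
      nlinarith
    have h2 : ((newtonOrder α g : ℕ) : ℝ) + (β 0 + β 1) ≤
        ((newtonOrder β g : ℕ) : ℝ) + (α 0 + α 1) := by
      exact_mod_cast hineq
    have h3 : (β 0 + β 1 : ℝ) < ((newtonOrder β g : ℕ) : ℝ) := by exact_mod_cast hbig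
    rw [hs 0, hs 1] at h2
    nlinarith
  · have hult := newtonOrder_lt_of_lt hlt hu hunit
    obtain ⟨a, ha, h0⟩ := hEα.exists_torus_root hα
    obtain ⟨c, hc⟩ := hNg α hα a ha h0
    -- The nonzero coefficient has order `p + 1 ≤ q`. The jet is long enough because `ν_α(u) ≥ 1`
    -- leaves room for one more coefficient.
    obtain ⟨z, hz, hne⟩ := exists_mem_jetStratum_coeff_ne_zero (m := m) hα ha h0 hc
      (n := m - newtonOrder α F) fun c => by
        have := hEα.le_newtonOrder hα c
        omega
    rw [show newtonOrder α g + (m - newtonOrder α F) = p by omega] at hz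
    have hcl := hsub hz
    refine hne (coeff_pullback_eq_zero_of_dvd hgh.symm.dvd (fun c => ?_)
      (coeff_pullback_eq_zero_of_mem_zariskiClosure hβ hcl) _ (by omega))
    exact coeff_jetSeries_eq_zero_of_mem_zariskiClosure hcl c 0 (hβ c)

end Main

end

end NewtonJets

theorem mainTheorem9 {k : Type*} [Field k] [IsAlgClosed k]
    (f : MvPolynomial (Fin 2) k)
    (hf : NewtonJets.IsNewtonPlaneCurve f) (hsing : NewtonJets.IsSingularAtOrigin f)
    (fi fj : MvPowerSeries (Fin 2) k)
    (hfi : NewtonJets.IsBranch f fi) (hfj : NewtonJets.IsBranch f fj)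
    (αi αj : Fin 2 → ℕ) (hαi : ∀ c, 0 < αi c) (hαj : ∀ c, 0 < αj c)
    (hTi : NewtonJets.tropicalVariety fi = NewtonJets.ray αi)
    (hTj : NewtonJets.tropicalVariety fj = NewtonJets.ray αj)
    (m : ℕ)
    (hmi : NewtonJets.newtonOrder αi (f : MvPowerSeries (Fin 2) k) ≤ m)
    (hmj : NewtonJets.newtonOrder αj (f : MvPowerSeries (Fin 2) k) ≤ m)
    (ki kj : ℕ)
    (hki : ki = NewtonJets.newtonOrder αi fi
      + (m - NewtonJets.newtonOrder αi (f : MvPowerSeries (Fin 2) k)))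
    (hkj : kj = NewtonJets.newtonOrder αj fj
      + (m - NewtonJets.newtonOrder αj (f : MvPowerSeries (Fin 2) k)))
    (hincl : NewtonJets.jetStratum fi αi ki m ⊆
      NewtonJets.zariskiClosure (NewtonJets.jetStratum fj αj kj m)) :
    αi = αj ∧
      NewtonJets.zariskiClosure (NewtonJets.jetStratum fi αi ki m) =
        NewtonJets.zariskiClosure (NewtonJets.jetStratum fj αj kj m) ∧
      Associated fi fj := by
  obtain ⟨hirri, u, hu⟩ := hfi
  obtain ⟨hirrj, v, hv⟩ := hfj
  have hF : (f : MvPowerSeries (Fin 2) k) ≠ 0 := by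
    rw [Ne, MvPolynomial.coe_eq_zero_iff]
    exact hf.squarefree.ne_zero
  have hu0 : u ≠ 0 := right_ne_zero_of_mul (hu ▸ hF)
  have hv0 : v ≠ 0 := right_ne_zero_of_mul (hv ▸ hF)
  have hN : ∀ γ : Fin 2 → ℕ, (∀ c, 0 < γ c) →
      NewtonJets.Nondegenerate γ (f : MvPowerSeries (Fin 2) k) :=
    fun γ hγ a ha h0 => hf.exists_pderiv_ne_zero hγ ha h0
  have hEi := NewtonJets.hasEdge_of_tropicalVariety_eq_ray hαi hirri.ne_zero hTi
  have hmuli := NewtonJets.newtonOrder_mul αi hirri.ne_zero hu0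
  have hmulj := NewtonJets.newtonOrder_mul αj hirrj.ne_zero hv0
  rw [← hu] at hmuli
  rw [← hv] at hmulj
  obtain ⟨hle, hass⟩ := NewtonJets.associated_of_subset_zariskiClosure (m := m) hirri hirrj
    (hu.symm.trans hv) hu0 hv0 hαi hαj hEi (by rw [← hu]; exact hN αi hαi)
    (by omega) (by omega) (by rw [← hu]; exact hmi) hincl
  have hT := NewtonJets.Associated.tropicalVariety_eq hass hirri.ne_zero
  have hEj := NewtonJets.hasEdge_of_tropicalVariety_eq_ray hαj hirri.ne_zero (hT.trans hTj)
  obtain ⟨s, -, hs⟩ := NewtonJets.exists_smul_of_ray_eq (hTi.symm.trans (hT.trans hTj))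
  obtain rfl := NewtonJets.eq_of_subset_zariskiClosure hirri hass hu hv hF hαi hαj hEi hEj hN
    hsing.coeff_single_eq_zero (by omega) (by omega) hmi hmj hs hle hincl
  refine ⟨rfl, ?_, hass⟩
  obtain rfl : ki = kj := by
    rw [hki, hkj, NewtonJets.newtonOrder_eq_of_associated hass hirri.ne_zero]
  rw [(NewtonJets.jetStratum_subset_of_dvd hass.dvd hαi ki).antisymm
    (NewtonJets.jetStratum_subset_of_dvd hass.symm.dvd hαi ki)]
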